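/- A permutation of length $n$ is a bijection of $\{1,\dots,n\}$, regarded as the sequence $\pi(1)\pi(2)\cdots\pi(n)$. An interval of $\pi$ is a set $I$ of contiguous indices such that the set of values $\pi(I)$ is also contiguous, and $\pi$ is simple if its only intervals are those of lengths $0$, $1$ and $n$. A copy of a permutation $\beta$ in $\pi$ is a subsequence of $\pi$ (determined by its set of positions) that is order isomorphic to $\beta$; $\pi$ avoids $\beta$ if it has no copy of $\beta$. Let $\operatorname{Av}(\beta_1,\dots,\beta_k)$ denote the set of permutations avoiding all of $\beta_1,\dots,\beta_k$, and, for nonnegative integers $r_1,\dots,r_k$, let $\operatorname{Av}(\beta_1^{\le r_1},\dots,\beta_k^{\le r_k})$ denote the set of permutations that have at most $r_i$ copies of $\beta_i$ for every $i$. Theorem (Brignall, Huczynska and Vatter). Let $\beta_1,\dots,\beta_k$ be permutations of length at least $1$. If $\operatorname{Av}(\beta_1,\dots,\beta_k)$ contains only finitely many simple permutations, then $\operatorname{Av}(\beta_1^{\le r_1},\dots,\beta_k^{\le r_k})$ also contains only finitely many simple permutations for all choices of nonnegative integers $r_1,\dots,r_k$. -/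

import Mathlib

namespace PermPattern

/-- A permutation of arbitrary finite length: a length `n` and a permutation of `Fin n`
(one-line notation `π 0, π 1, …, π (n - 1)`). -/
abbrev FinPerm : Type := Σ n : ℕ, Equiv.Perm (Fin n)

/-- The length of a permutation. -/
abbrev FinPerm.length (π : FinPerm) : ℕ := π.1

/-- An interval of a permutation: a (possibly empty) set of contiguous indices whose set of
values is also contiguous. -/
def IsInterval {n : ℕ} (π : Equiv.Perm (Fin n)) (I : Set (Fin n)) : Prop :=
  I.OrdConnected ∧ (π '' I).OrdConnected

/-- A permutation is simple if its only intervals are the empty one, the singletons and the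
whole index set. -/
def IsSimple (π : FinPerm) : Prop :=
  ∀ I : Set (Fin π.length), IsInterval π.2 I → I.Subsingleton ∨ I = Set.univ

/-- The copies of `β` in `π`: the subsequences of `π`, each given by the strictly increasing
sequence of its positions, that are order isomorphic to `β`. -/
def copies (β π : FinPerm) : Set (Fin β.length ↪o Fin π.length) :=
  {e | ∀ i j, β.2 i < β.2 j ↔ π.2 (e i) < π.2 (e j)}

/-- `π` contains `β`, i.e. `β ≤ π` in the pattern containment order. -/
def Contains (π β : FinPerm) : Prop := (copies β π).Nonempty

/-- The number of copies of `β` in `π`. -/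
noncomputable def numCopies (β π : FinPerm) : ℕ := (copies β π).ncard

/-- `Av(β₁, …, βₖ)`: the permutations that avoid every `βᵢ`. -/
def Av {k : ℕ} (β : Fin k → FinPerm) : Set FinPerm :=
  {π | ∀ i, ¬ Contains π (β i)}

/-- `Av(β₁^{≤ r₁}, …, βₖ^{≤ rₖ})`: the permutations with at most `rᵢ` copies of `βᵢ`,
for every `i`. -/
def AvAtMost {k : ℕ} (β : Fin k → FinPerm) (r : Fin k → ℕ) : Set FinPerm :=
  {π | ∀ i, numCopies (β i) π ≤ r i}

/-- `Si(C)`: the simple permutations in `C`. -/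
def Si (C : Set FinPerm) : Set FinPerm := {π | π ∈ C ∧ IsSimple π}

end PermPattern

/-! View a permutation as its plot. An interval is a set of points whose bounding rectangle no
outside point slices, so simplicity is primality for the map recording relative positions of pairs,
and any prime set of points standardizes to a simple pattern. If every simple permutation of length
at least `L` contains some `β i`, it is enough that a long simple permutation has `∑ r i + 1` prime
sets, pairwise disjoint except for at most two common points, each with at least `L` points of its
own (`exists_hasAlmostDisjointPrimes`). Each set holds a copy of some `β i` that meets its own
points (`exists_copy_meeting`), so these copies are distinct and too numerous.

To find the sets, start from two points and keep adding all points that slice the current rectangle.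
Slow growth produces a long chain in which each term separates its predecessor from everything
earlier; blocks of a chain become prime after deleting at most two points each
(`IsSepChain.exists_isPrimeOn`). If all growth is fast, many horizontally disjoint pairs reach one
fixed point in the same number of steps, and tracing this back gives a long alternation
(`hasAlternation_of_common_level`).

By Erdős–Szekeres both rows of the alternation may be taken monotone. Parallel rows split directly
into prime blocks. Rows forming a wedge do not, but fast growth from the innermost layer must skip
many layers in a single step; the point that does so, with at most one more, makes every block of
skipped layers prime (`hasAlmostDisjointPrimes_of_wedge`). -/

namespace PermPattern

/-! ### Modules, twins, and deleting at most two points to reach a prime set -/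

section Modules

variable {V T : Type*} {ty : V → V → T} {S A B : Set V}

/-- `A` is a module of `S` if no element of `S` outside `A` distinguishes two elements of `A`. -/
def IsModule (ty : V → V → T) (S A : Set V) : Prop :=
  A ⊆ S ∧ ∀ v ∈ S, v ∉ A → ∀ a ∈ A, ∀ b ∈ A, ty v a = ty v b

/-- `S` is prime if all its modules are trivial. -/
def IsPrimeOn (ty : V → V → T) (S : Set V) : Prop :=
  ∀ A, IsModule ty S A → A.Subsingleton ∨ A = S

/-- The type of a pair determines the type of the reversed pair. -/
def Reversible (ty : V → V → T) : Prop :=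
  ∀ a b c d, a ≠ b → c ≠ d → ty a b = ty c d → ty b a = ty d c

theorem IsModule.trans (hA : IsModule ty S A) (hB : IsModule ty A B) : IsModule ty S B := by
  refine ⟨hB.1.trans hA.1, fun v hv hvB a ha b hb => ?_⟩
  by_cases hvA : v ∈ A
  · exact hB.2 v hvA hvB a ha b hb
  · exact hA.2 v hv hvA a (hB.1 ha) b (hB.1 hb)

/-- The points `p` and `r` are twins: each element of `B` sees them alike, so by reversibility `p`
sees `B` as `r` does, and `r` does not split `B`. -/
theorem IsModule.of_diff_of_notMem (hty : Reversible ty) {p r : V} (hr : r ∈ S)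
    (hpr : p ≠ r) (h : IsModule ty S {p, r}) (hB : IsModule ty (S \ {p}) B) (hrB : r ∉ B) :
    IsModule ty S B := by
  refine ⟨hB.1.trans Set.sdiff_subset, fun v hv hvB a ha b hb => ?_⟩
  by_cases hvp : v = p
  · subst hvp
    have key : ∀ c ∈ B, ty v c = ty r c := fun c hc => by
      have hcp : c ≠ v := fun e => (hB.1 hc).2 e
      have hcr : c ≠ r := fun e => hrB (e ▸ hc)
      exact hty c v c r hcp hcr
        (h.2 c (hB.1 hc).1 (by simp [hcp, hcr]) v (by simp) r (by simp))
    rw [key a ha, key b hb]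
    exact hB.2 r ⟨hr, fun e => hpr e.symm⟩ hrB a ha b hb
  · exact hB.2 v ⟨hv, hvp⟩ hvB a ha b hb

theorem IsModule.insert_of_diff {p r : V} (hp : p ∈ S)
    (h : IsModule ty S {p, r}) (hB : IsModule ty (S \ {p}) B) (hrB : r ∈ B) :
    IsModule ty S (insert p B) := by
  refine ⟨Set.insert_subset hp (hB.1.trans Set.sdiff_subset), fun v hv hvB a ha b hb => ?_⟩
  rw [Set.mem_insert_iff, not_or] at hvB
  have key : ∀ c ∈ insert p B, ty v c = ty v r := by
    rintro c (rfl | hc)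
    · exact h.2 v hv (by
        rintro (e | e)
        · exact hvB.1 e
        · exact hvB.2 (e ▸ hrB)) _ (by simp) _ (by simp)
    · exact hB.2 v ⟨hv, hvB.1⟩ hvB.2 c hc r hrB
  rw [key a ha, key b hb]

/-- Modules of the module `S \ {p}` are modules of `S`, so after deleting `p` only `{q, r}` can be
nontrivial. If it is a module, deleting its twin `q` finishes. -/
theorem exists_isPrimeOn_of_isModule_diff (hty : Reversible ty) {p q r : V} (hq : q ∈ S)
    (hr : r ∈ S) (hpq : p ≠ q) (hpr : p ≠ r) (hqr : q ≠ r)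
    (H : ∀ A, IsModule ty S A → A.Subsingleton ∨ A = S ∨ A = S \ {p} ∨ A = S \ {q} ∨
      A = {p, r} ∨ A = {q, r}) (hp : p ∈ S) (h : IsModule ty S (S \ {p})) :
    ∃ S' ⊆ S, S \ {p, q} ⊆ S' ∧ IsPrimeOn ty S' := by
  have H' : ∀ B, IsModule ty (S \ {p}) B → B.Subsingleton ∨ B = S \ {p} ∨ B = {q, r} := by
    intro B hB
    have hpB : p ∉ B := fun e => (hB.1 e).2 rfl
    rcases H B (h.trans hB) with h1 | rfl | h1 | rfl | rfl | h1
    · exact Or.inl h1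
    · exact absurd hp hpB
    · exact Or.inr (Or.inl h1)
    · exact absurd ⟨hp, hpq⟩ hpB
    · simp at hpB
    · exact Or.inr (Or.inr h1)
  by_cases hm : IsModule ty (S \ {p}) {q, r}
  · refine ⟨(S \ {p}) \ {q}, Set.sdiff_subset.trans Set.sdiff_subset, ?_, ?_⟩
    · rintro v ⟨hv, hv'⟩
      simp only [Set.mem_insert_iff, Set.mem_singleton_iff, not_or] at hv'
      exact ⟨⟨hv, hv'.1⟩, hv'.2⟩
    · intro B hB
      have hqB : q ∉ B := fun e => (hB.1 e).2 rfl
      have hrp : r ∈ S \ {p} := ⟨hr, fun e => hpr e.symm⟩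
      by_cases hrB : r ∈ B
      · have hi := hm.insert_of_diff (p := q) (r := r)
          (show q ∈ S \ {p} from ⟨hq, fun e => hpq e.symm⟩) hB hrB
        rcases H' _ hi with h1 | h1 | h1
        · exact absurd (h1 (by simp) (by simp [hrB])) hqr
        · right
          rw [← h1]
          simp [hqB]
        · left
          intro a ha b hb
          have ha' : a ∈ ({q, r} : Set V) := h1 ▸ Set.mem_insert_of_mem _ ha
          have hb' : b ∈ ({q, r} : Set V) := h1 ▸ Set.mem_insert_of_mem _ hb
          rcases ha' with rfl | rfl
          · exact absurd ha hqB
          rcases hb' with rfl | rfl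
          · exact absurd hb hqB
          rfl
      · rcases H' _ (hm.of_diff_of_notMem hty hrp hqr hB hrB) with h1 | rfl | rfl
        · exact Or.inl h1
        · exact absurd hrp hrB
        · simp at hrB
  · refine ⟨S \ {p}, Set.sdiff_subset, Set.sdiff_subset_sdiff_right (by simp), fun B hB => ?_⟩
    rcases H' B hB with h1 | h1 | rfl
    · exact Or.inl h1
    · exact Or.inr h1
    · exact absurd hB hm

/-- Since `p` is a twin of `r`, modules of `S \ {p}` lift to `S`, with `p` added when they contain
`r`. Only `S \ {p, q}` can then be nontrivial; if it is a module, its own modules are modules of `S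
\ {p}`, so it is prime. -/
theorem exists_isPrimeOn_of_isModule_pair (hty : Reversible ty) {p q r : V} (hq : q ∈ S)
    (hr : r ∈ S) (hpq : p ≠ q) (hpr : p ≠ r) (hqr : q ≠ r)
    (H : ∀ A, IsModule ty S A → A.Subsingleton ∨ A = S ∨ A = S \ {p} ∨ A = S \ {q} ∨
      A = {p, r} ∨ A = {q, r}) (hp : p ∈ S) (h : IsModule ty S {p, r}) :
    ∃ S' ⊆ S, S \ {p, q} ⊆ S' ∧ IsPrimeOn ty S' := by
  have H' : ∀ B, IsModule ty (S \ {p}) B →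
      B.Subsingleton ∨ B = S \ {p} ∨ B = (S \ {p}) \ {q} := by
    intro B hB
    have hpB : p ∉ B := fun e => (hB.1 e).2 rfl
    by_cases hrB : r ∈ B
    · have hB' : insert p B \ {p} = B := by simp [hpB]
      rcases H _ (h.insert_of_diff hp hB hrB) with h1 | h1 | h1 | h1 | h1 | h1
      · exact absurd (h1 (by simp) (by simp [hrB])) hpr
      · exact Or.inr (Or.inl (by rw [← hB', h1]))
      · exact absurd (h1 ▸ Set.mem_insert p B : p ∈ S \ {p}) (by simp)
      · refine Or.inr (Or.inr ?_)
        rw [← hB', h1, Set.sdiff_sdiff_comm]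
      · left
        rw [← hB', h1]
        intro a ha b hb
        simp only [Set.mem_sdiff, Set.mem_insert_iff, Set.mem_singleton_iff] at ha hb
        grind
      · have : p ∈ ({q, r} : Set V) := h1 ▸ Set.mem_insert p B
        simp [hpq, hpr] at this
    · rcases H _ (h.of_diff_of_notMem hty hr hpr hB hrB) with h1 | rfl | rfl | rfl | rfl | rfl
      · exact Or.inl h1
      · exact absurd hr hrB
      · exact absurd ⟨hr, fun e => hpr e.symm⟩ hrB
      · exact absurd ⟨hr, fun e => hqr e.symm⟩ hrB
      · simp at hrB
      · simp at hrB
  by_cases hm : IsModule ty (S \ {p}) ((S \ {p}) \ {q})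
  · refine ⟨(S \ {p}) \ {q}, Set.sdiff_subset.trans Set.sdiff_subset, ?_, fun B hB => ?_⟩
    · rintro v ⟨hv, hv'⟩
      simp only [Set.mem_insert_iff, Set.mem_singleton_iff, not_or] at hv'
      exact ⟨⟨hv, hv'.1⟩, hv'.2⟩
    · rcases H' B (hm.trans hB) with h1 | h1 | h1
      · exact Or.inl h1
      · have : q ∈ B := h1 ▸ ⟨hq, fun e => hpq e.symm⟩
        exact absurd rfl (hB.1 this).2
      · exact Or.inr h1
  · refine ⟨S \ {p}, Set.sdiff_subset, Set.sdiff_subset_sdiff_right (by simp), fun B hB => ?_⟩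
    rcases H' B hB with h1 | h1 | rfl
    · exact Or.inl h1
    · exact Or.inr h1
    · exact absurd hB hm

theorem exists_isPrimeOn_of_forall_isModule (hty : Reversible ty) {p q r : V} (hp : p ∈ S)
    (hq : q ∈ S) (hr : r ∈ S) (hpq : p ≠ q) (hpr : p ≠ r) (hqr : q ≠ r)
    (H : ∀ A, IsModule ty S A → A.Subsingleton ∨ A = S ∨ A = S \ {p} ∨ A = S \ {q} ∨
      A = {p, r} ∨ A = {q, r}) :
    ∃ S' ⊆ S, S \ {p, q} ⊆ S' ∧ IsPrimeOn ty S' := by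
  have H' : ∀ A, IsModule ty S A → A.Subsingleton ∨ A = S ∨ A = S \ {q} ∨ A = S \ {p} ∨
      A = {q, r} ∨ A = {p, r} := fun A hA => by
    rcases H A hA with h | h | h | h | h | h <;> tauto
  by_cases h1 : IsModule ty S (S \ {p})
  · exact exists_isPrimeOn_of_isModule_diff hty hq hr hpq hpr hqr H hp h1
  by_cases h2 : IsModule ty S (S \ {q})
  · rw [Set.pair_comm]
    exact exists_isPrimeOn_of_isModule_diff hty hp hr hpq.symm hqr hpr H' hq h2
  by_cases h3 : IsModule ty S {p, r}
  · exact exists_isPrimeOn_of_isModule_pair hty hq hr hpq hpr hqr H hp h3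
  by_cases h4 : IsModule ty S {q, r}
  · rw [Set.pair_comm]
    exact exists_isPrimeOn_of_isModule_pair hty hp hr hpq.symm hqr hpr H' hq h4
  refine ⟨S, subset_rfl, Set.sdiff_subset, fun A hA => ?_⟩
  rcases H A hA with h | h | rfl | rfl | rfl | rfl
  · exact Or.inl h
  · exact Or.inr h
  all_goals contradiction

end Modules

/-! ### Separating chains and their prime subsets -/

section Chains

variable {V T : Type*} {ty : V → V → T}

/-- A chain: every term after the second distinguishes its predecessor from all earlier terms,
which it does not distinguish from each other. -/
structure IsSepChain (ty : V → V → T) (v : ℕ → V) (m : ℕ) : Prop where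
  ne : ∀ i j, i < j → j < m → v i ≠ v j
  same : ∀ t k, t < m → k + 2 ≤ t → ty (v t) (v k) = ty (v t) (v 0)
  sep : ∀ t, t + 2 < m → ty (v (t + 2)) (v (t + 1)) ≠ ty (v (t + 2)) (v 0)

theorem IsSepChain.shift {v : ℕ → V} {m : ℕ} (h : IsSepChain ty v m) (s l : ℕ)
    (hl : s + l ≤ m) : IsSepChain ty (fun i => v (s + i)) l := by
  refine ⟨fun i j hij hj => h.ne _ _ (by omega) (by omega), fun t k ht hk => ?_, fun t ht => ?_⟩
  · rw [h.same (s + t) (s + k) (by omega) (by omega), h.same (s + t) (s + 0) (by omega) (by omega)]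
  · have := h.sep (s + t) (by omega)
    rw [← h.same (s + t + 2) (s + 0) (by omega) (by omega)] at this
    exact this

/-- As `v (l + 1)` and `v k` lie outside, each sees `v (l + 2)` and `v e` alike. But `v e` comes too
late to distinguish `v (l + 1)` from `v k`, so `v (l + 2)` would not distinguish them either,
against `sep`. -/
theorem IsSepChain.not_two_outside (hty : Reversible ty) {v : ℕ → V} {m : ℕ}
    (h : IsSepChain ty v m) {A : Set V} (hA : IsModule ty (v '' {i | i < m}) A) {k l e : ℕ}
    (hk : k ≤ l) (hle : l + 2 < e) (he : e < m) (h2 : v (l + 2) ∈ A) (h3 : v e ∈ A)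
    (h1 : v (l + 1) ∉ A) (h0 : v k ∉ A) : False := by
  have m1 : ∀ i, i < m → v i ∈ v '' {i | i < m} := fun i hi => ⟨i, hi, rfl⟩
  have e1 := hA.2 _ (m1 (l + 1) (by omega)) h1 _ h2 _ h3
  have e0 := hA.2 _ (m1 k (by omega)) h0 _ h2 _ h3
  have f1 := hty _ _ _ _ (h.ne (l + 1) (l + 2) (by omega) (by omega))
    (h.ne (l + 1) e (by omega) (by omega)) e1
  have f0 := hty _ _ _ _ (h.ne k (l + 2) (by omega) (by omega))
    (h.ne k e (by omega) (by omega)) e0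
  apply h.sep l (by omega)
  rw [f1, h.same e (l + 1) he (by omega), ← h.same e k he (by omega), ← f0,
    h.same (l + 2) k (by omega) (by omega)]

/-- A nontrivial module consists of one term together with a final segment of the chain, and
`not_two_outside` leaves only the shapes that deleting one or both of `v 0` and `v 1` destroys. -/
theorem IsSepChain.exists_isPrimeOn (hty : Reversible ty) {v : ℕ → V} {m : ℕ}
    (h : IsSepChain ty v m) (hm : 3 ≤ m) :
    ∃ S' ⊆ v '' {i | i < m}, v '' {i | 2 ≤ i ∧ i < m} ⊆ S' ∧ IsPrimeOn ty S' := by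
  have mem : ∀ i, i < m → v i ∈ v '' {i | i < m} := fun i hi => ⟨i, hi, rfl⟩
  have inj : ∀ i j, i < m → j < m → v i = v j → i = j := fun i j hi hj e => by
    by_contra hne
    rcases Nat.lt_or_gt_of_ne hne with hlt | hlt
    · exact h.ne i j hlt hj e
    · exact h.ne j i hlt hi e.symm
  have key : ∀ A, IsModule ty (v '' {i | i < m}) A → A.Subsingleton ∨ A = v '' {i | i < m} ∨
      A = (v '' {i | i < m}) \ {v 0} ∨ A = (v '' {i | i < m}) \ {v 1} ∨
      A = {v 0, v (m - 1)} ∨ A = {v 1, v (m - 1)} := by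
    intro A hA
    by_cases hsub : A.Subsingleton
    · exact Or.inl hsub
    right
    rw [Set.not_subsingleton_iff] at hsub
    obtain ⟨a, ha, b, hb, hab⟩ := hsub
    classical
    have hex : ∃ i, i < m ∧ v i ∈ A := by
      obtain ⟨i, hi, rfl⟩ := hA.1 ha
      exact ⟨i, hi, ha⟩
    obtain ⟨hi, hiA⟩ := Nat.find_spec hex
    have hmin : ∀ k, k < Nat.find hex → v k ∉ A := fun k hk hkA =>
      Nat.find_min hex hk ⟨by omega, hkA⟩
    generalize Nat.find hex = i at hi hiA hmin
    have hex2 : ∃ j, i < j ∧ j < m ∧ v j ∈ A := by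
      obtain ⟨s, hs, rfl⟩ := hA.1 ha
      obtain ⟨t, ht, rfl⟩ := hA.1 hb
      by_cases hsi : i < s
      · exact ⟨s, hsi, hs, ha⟩
      by_cases hti : i < t
      · exact ⟨t, hti, ht, hb⟩
      have hs' : s = i := le_antisymm (not_lt.1 hsi) (not_lt.1 fun hlt => hmin s hlt ha)
      have ht' : t = i := le_antisymm (not_lt.1 hti) (not_lt.1 fun hlt => hmin t hlt hb)
      exact absurd (by rw [hs', ht']) hab
    obtain ⟨hij, hj, hjA⟩ := Nat.find_spec hex2
    have hmin2 : ∀ k, i < k → k < Nat.find hex2 → v k ∉ A := fun k hik hk hkA =>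
      Nat.find_min hex2 hk ⟨hik, by omega, hkA⟩
    generalize Nat.find hex2 = j at hij hj hjA hmin2
    have hout : ∀ k, k < j → k ≠ i → v k ∉ A := fun k hk hki => by
      rcases Nat.lt_or_gt_of_ne hki with hlt | hlt
      · exact hmin k hlt
      · exact hmin2 k hlt hk
    -- The term after `v k` separates `v k` from the earlier member `v i`, so it cannot stay outside
    -- the module.
    have hup : ∀ k, j ≤ k → k < m → v k ∈ A := by
      intro k hk
      induction k, hk using Nat.le_induction with
      | base => exact fun _ => hjA
      | succ k hk ih =>
        intro hkm
        by_contra hkA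
        obtain ⟨t, rfl⟩ : ∃ t, k = t + 1 := ⟨k - 1, by omega⟩
        apply h.sep t hkm
        rw [← h.same (t + 2) i hkm (by omega)]
        exact hA.2 _ (mem _ hkm) hkA _ (ih (by omega)) _ hiA
    have hA' : ∀ k, k < m → (v k ∈ A ↔ k = i ∨ j ≤ k) := fun k hk => by
      constructor
      · intro hkA
        by_contra hcon
        exact hout k (by omega) (by omega) hkA
      · rintro (rfl | hjk)
        · exact hiA
        · exact hup k hjk hk
    have ext : ∀ B ⊆ v '' {i | i < m}, (∀ k, k < m → (v k ∈ B ↔ k = i ∨ j ≤ k)) → A = B := by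
      intro B hB hB'
      ext w
      constructor
      · intro hw
        obtain ⟨k, hk, rfl⟩ := hA.1 hw
        exact (hB' k hk).2 ((hA' k hk).1 hw)
      · intro hw
        obtain ⟨k, hk, rfl⟩ := hB hw
        exact (hA' k hk).2 ((hB' k hk).1 hw)
    have ext1 : ∀ c, c < m → (∀ k, k < m → (k ≠ c ↔ k = i ∨ j ≤ k)) →
        A = (v '' {i | i < m}) \ {v c} := by
      intro c hc hc'
      refine ext _ Set.sdiff_subset fun k hk => ?_
      rw [← hc' k hk]
      simp only [Set.mem_sdiff, mem k hk, true_and, Set.mem_singleton_iff]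
      exact not_congr ⟨fun e => inj k c hk hc e, fun e => by rw [e]⟩
    have ext2 : j = m - 1 → A = {v i, v (m - 1)} := by
      intro hjm
      refine ext _ ?_ fun k hk => ?_
      · rintro w (rfl | rfl)
        · exact mem _ hi
        · exact mem _ (by omega)
      · constructor
        · rintro (e | e)
          · exact Or.inl (inj _ _ hk hi e)
          · exact Or.inr (by have := inj _ _ hk (by omega) e; omega)
        · rintro (rfl | hjk)
          · simp
          · obtain rfl : k = m - 1 := by omega
            simp
    by_cases hjm : j = m - 1
    · have hi2 : i < 2 := by
        by_contra hi2
        obtain ⟨l, rfl⟩ : ∃ l, i = l + 2 := ⟨i - 2, by omega⟩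
        exact h.not_two_outside hty hA (k := 0) (l := l) (e := m - 1) (by omega) (by omega)
          (by omega) hiA (hjm ▸ hjA) (hout _ (by omega) (by omega)) (hout _ (by omega) (by omega))
      have := ext2 hjm
      obtain rfl | rfl : i = 0 ∨ i = 1 := by omega
      · tauto
      · tauto
    · by_cases hij' : j = i + 1
      · have hi2 : i < 2 := by
          by_contra hi2
          obtain ⟨l, rfl⟩ : ∃ l, i = l + 2 := ⟨i - 2, by omega⟩
          exact h.not_two_outside hty hA (k := 0) (l := l) (e := j) (by omega) (by omega)
            hj hiA hjA (hout _ (by omega) (by omega)) (hout _ (by omega) (by omega))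
        obtain rfl | rfl : i = 0 ∨ i = 1 := by omega
        · exact Or.inl (ext _ subset_rfl fun k hk => by simp only [mem k hk, true_iff]; omega)
        · exact Or.inr (Or.inl (ext1 0 (by omega) fun k hk => by omega))
      · have hj2 : j = 2 ∧ i = 0 := by
          by_contra hcon
          obtain ⟨l, rfl⟩ : ∃ l, j = l + 2 := ⟨j - 2, by omega⟩
          obtain ⟨k, hk, hki⟩ : ∃ k, k ≤ l ∧ k ≠ i := by
            by_cases h0 : i = 0
            · exact ⟨1, by omega, by omega⟩
            · exact ⟨0, by omega, by omega⟩
          exact h.not_two_outside hty hA (k := k) (l := l) (e := l + 3) hk (by omega)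
            (by omega) hjA (hup _ (by omega) (by omega)) (hout _ (by omega) (by omega))
            (hout _ (by omega) hki)
        obtain ⟨rfl, rfl⟩ := hj2
        exact Or.inr (Or.inr (Or.inl (ext1 1 (by omega) fun k hk => by omega)))
  obtain ⟨S', h1, h2, h3⟩ := exists_isPrimeOn_of_forall_isModule (ty := ty) (S := v '' {i | i < m})
    hty (p := v 0) (q := v 1) (r := v (m - 1)) (mem _ (by omega)) (mem _ (by omega))
    (mem _ (by omega)) (h.ne _ _ (by omega) (by omega)) (h.ne _ _ (by omega) (by omega))
    (h.ne _ _ (by omega) (by omega)) key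
  refine ⟨S', h1, subset_trans ?_ h2, h3⟩
  rintro _ ⟨i, ⟨hi, hi'⟩, rfl⟩
  refine ⟨mem i hi', ?_⟩
  simp only [Set.mem_insert_iff, Set.mem_singleton_iff, not_or]
  exact ⟨(h.ne _ _ (by omega) hi').symm, (h.ne _ _ (by omega) hi').symm⟩

end Chains

/-! ### Points in the plane: slicing and almost disjoint prime sets -/

section Points

variable {V : Type*} {x y : V → ℤ} {A S : Set V}

/-- The relative position of two points in the plane with coordinate functions `x` and `y`. -/
def relPos (x y : V → ℤ) (a b : V) : Prop × Prop := (x a < x b, y a < y b)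

theorem relPos_eq_iff {a b c d : V} :
    relPos x y a b = relPos x y c d ↔ (x a < x b ↔ x c < x d) ∧ (y a < y b ↔ y c < y d) := by
  simp [relPos]

theorem reversible_relPos (hx : x.Injective) (hy : y.Injective) : Reversible (relPos x y) := by
  intro a b c d hab hcd h
  rw [relPos_eq_iff] at h ⊢
  have := hx.ne hab
  have := hx.ne hcd
  have := hy.ne hab
  have := hy.ne hcd
  omega

/-- `v` slices the bounding rectangle of `A`. -/
def Cuts (x y : V → ℤ) (v : V) (A : Set V) : Prop :=
  (∃ a ∈ A, ∃ b ∈ A, x a < x v ∧ x v < x b) ∨ (∃ a ∈ A, ∃ b ∈ A, y a < y v ∧ y v < y b)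

theorem cuts_swap {v : V} : Cuts y x v A ↔ Cuts x y v A := or_comm

theorem cuts_neg {v : V} : Cuts x (fun w => -y w) v A ↔ Cuts x y v A := by
  unfold Cuts
  refine or_congr Iff.rfl ⟨?_, ?_⟩ <;>
  · rintro ⟨a, ha, b, hb, h1, h2⟩
    beta_reduce at *
    exact ⟨b, hb, a, ha, by omega, by omega⟩

theorem cuts_iff (hx : x.Injective) (hy : y.Injective) {v : V} (hv : v ∉ A) :
    Cuts x y v A ↔ ∃ a ∈ A, ∃ b ∈ A, relPos x y v a ≠ relPos x y v b := by
  have hne : ∀ a ∈ A, x a ≠ x v ∧ y a ≠ y v := fun a ha =>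
    ⟨hx.ne fun e => hv (e ▸ ha), hy.ne fun e => hv (e ▸ ha)⟩
  constructor
  · rintro (⟨a, ha, b, hb, h1, h2⟩ | ⟨a, ha, b, hb, h1, h2⟩) <;>
    · refine ⟨a, ha, b, hb, fun h => ?_⟩
      rw [relPos_eq_iff] at h
      omega
  · rintro ⟨a, ha, b, hb, h⟩
    rw [Ne, relPos_eq_iff] at h
    have ha' := hne a ha
    have hb' := hne b hb
    by_cases h1 : x v < x a ↔ x v < x b
    · right
      by_cases h2 : y v < y a
      · exact ⟨b, hb, a, ha, by omega, by omega⟩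
      · exact ⟨a, ha, b, hb, by omega, by omega⟩
    · left
      by_cases h2 : x v < x a
      · exact ⟨b, hb, a, ha, by omega, by omega⟩
      · exact ⟨a, ha, b, hb, by omega, by omega⟩

theorem isModule_relPos_iff (hx : x.Injective) (hy : y.Injective) :
    IsModule (relPos x y) S A ↔ A ⊆ S ∧ ∀ v ∈ S, v ∉ A → ¬ Cuts x y v A := by
  refine and_congr Iff.rfl (forall_congr' fun v => forall_congr' fun _ =>
    forall_congr' fun hv => ?_)
  rw [cuts_iff hx hy hv]
  push Not
  rfl

theorem isPrimeOn_swap (hx : x.Injective) (hy : y.Injective) :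
    IsPrimeOn (relPos y x) S ↔ IsPrimeOn (relPos x y) S := by
  simp only [IsPrimeOn, isModule_relPos_iff hx hy, isModule_relPos_iff hy hx, cuts_swap]

theorem neg_comp_injective (hy : y.Injective) : (fun v => -y v).Injective :=
  neg_injective.comp hy

theorem isPrimeOn_neg (hx : x.Injective) (hy : y.Injective) :
    IsPrimeOn (relPos x (fun v => -y v)) S ↔ IsPrimeOn (relPos x y) S := by
  simp only [IsPrimeOn, isModule_relPos_iff hx hy,
    isModule_relPos_iff hx (neg_comp_injective hy), cuts_neg]

theorem isPrimeOn_of_forall_closed (hx : x.Injective) (hy : y.Injective)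
    (h : ∀ A ⊆ S, (∀ v ∈ S, ∀ a ∈ A, ∀ b ∈ A, x a < x v → x v < x b → v ∈ A) →
      (∀ v ∈ S, ∀ a ∈ A, ∀ b ∈ A, y a < y v → y v < y b → v ∈ A) →
      ∀ p ∈ A, ∀ q ∈ A, p ≠ q → S ⊆ A) : IsPrimeOn (relPos x y) S := by
  intro A hA
  rw [isModule_relPos_iff hx hy] at hA
  by_cases hs : A.Subsingleton
  · exact Or.inl hs
  rw [Set.not_subsingleton_iff] at hs
  obtain ⟨p, hp, q, hq, hpq⟩ := hs
  refine Or.inr (hA.1.antisymm (h A hA.1 ?_ ?_ p hp q hq hpq))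
  · intro v hv a ha b hb h1 h2
    by_contra hvA
    exact hA.2 v hv hvA (Or.inl ⟨a, ha, b, hb, h1, h2⟩)
  · intro v hv a ha b hb h1 h2
    by_contra hvA
    exact hA.2 v hv hvA (Or.inr ⟨a, ha, b, hb, h1, h2⟩)

/-- There are `M` disjoint sets of points that become prime sets of size at least `L` after adding
at most two common points; if common points are needed then each of the sets contains an
ascending and a descending pair. -/
def HasAlmostDisjointPrimes (x y : V → ℤ) (L M : ℕ) : Prop :=
  ∃ (C : Set V) (S : ℕ → Set V), C.ncard ≤ 2 ∧
    (∀ i j, i < M → j < M → i ≠ j → Disjoint (S i) (S j)) ∧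
    ∀ i < M, Disjoint C (S i) ∧ L ≤ (S i).ncard ∧ IsPrimeOn (relPos x y) (C ∪ S i) ∧
      (C = ∅ ∨ (∃ p ∈ S i, ∃ q ∈ S i, x p < x q ∧ y p < y q) ∧
        ∃ p ∈ S i, ∃ q ∈ S i, x p < x q ∧ y q < y p)

theorem HasAlmostDisjointPrimes.of_swap (hx : x.Injective) (hy : y.Injective) {L M : ℕ}
    (h : HasAlmostDisjointPrimes y x L M) : HasAlmostDisjointPrimes x y L M := by
  obtain ⟨C, S, hC, hd, h⟩ := h
  refine ⟨C, S, hC, hd, fun i hi => ?_⟩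
  obtain ⟨h1, h2, h3, h4⟩ := h i hi
  refine ⟨h1, h2, (isPrimeOn_swap hx hy).1 h3, h4.imp_right ?_⟩
  rintro ⟨⟨p, hp, q, hq, h5, h6⟩, ⟨p', hp', q', hq', h7, h8⟩⟩
  exact ⟨⟨p, hp, q, hq, h6, h5⟩, ⟨q', hq', p', hp', h8, h7⟩⟩

theorem HasAlmostDisjointPrimes.of_neg (hx : x.Injective) (hy : y.Injective) {L M : ℕ}
    (h : HasAlmostDisjointPrimes x (fun v => -y v) L M) : HasAlmostDisjointPrimes x y L M := by
  obtain ⟨C, S, hC, hd, h⟩ := h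
  refine ⟨C, S, hC, hd, fun i hi => ?_⟩
  obtain ⟨h1, h2, h3, h4⟩ := h i hi
  refine ⟨h1, h2, (isPrimeOn_neg hx hy).1 h3, h4.imp_right ?_⟩
  rintro ⟨⟨p, hp, q, hq, h5, h6⟩, ⟨p', hp', q', hq', h7, h8⟩⟩
  beta_reduce at *
  exact ⟨⟨p', hp', q', hq', h7, by omega⟩, ⟨p, hp, q, hq, h5, by omega⟩⟩

/-- The chain is cut into `M` blocks. A block of length `L + 3` meets the lower bound `3` and keeps
more than `L` terms after losing its first two. -/
theorem hasAlmostDisjointPrimes_of_isSepChain [Finite V] (hx : x.Injective) (hy : y.Injective)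
    {L M : ℕ} {v : ℕ → V} (h : IsSepChain (relPos x y) v (M * (L + 3))) :
    HasAlmostDisjointPrimes x y L M := by
  have key : ∀ i, ∃ S' : Set V, i < M → S' ⊆ (fun k => v (i * (L + 3) + k)) '' {k | k < L + 3} ∧
      (fun k => v (i * (L + 3) + k)) '' {k | 2 ≤ k ∧ k < L + 3} ⊆ S' ∧
      IsPrimeOn (relPos x y) S' := by
    intro i
    by_cases hi : i < M
    · have hle : i * (L + 3) + (L + 3) ≤ M * (L + 3) := by
        have := Nat.mul_le_mul_right (L + 3) hi
        rwa [Nat.succ_mul] at this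
      obtain ⟨S', hS'⟩ := (h.shift (i * (L + 3)) (L + 3) hle).exists_isPrimeOn
        (reversible_relPos hx hy) (by omega)
      exact ⟨S', fun _ => hS'⟩
    · exact ⟨∅, fun h => absurd h hi⟩
  have hinj : ∀ s t, s < M * (L + 3) → t < M * (L + 3) → v s = v t → s = t := fun s t hs ht e => by
    by_contra hne
    rcases Nat.lt_or_gt_of_ne hne with hlt | hlt
    · exact h.ne s t hlt ht e
    · exact h.ne t s hlt hs e.symm
  have hlt : ∀ i k, i < M → k < L + 3 → i * (L + 3) + k < M * (L + 3) := fun i k hi hk => by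
    have := Nat.mul_le_mul_right (L + 3) hi
    rw [Nat.succ_mul] at this
    omega
  choose S hS using key
  refine ⟨∅, S, by simp, fun i j hi hj hij => ?_, fun i hi => ⟨by simp, ?_, ?_, Or.inl rfl⟩⟩
  · rw [Set.disjoint_left]
    intro w hw hw'
    obtain ⟨k, hk, rfl⟩ := (hS i hi).1 hw
    obtain ⟨l, hl, e⟩ := (hS j hj).1 hw'
    have e' := hinj _ _ (hlt j l hj hl) (hlt i k hi hk) e
    apply hij
    have h1 : (i * (L + 3) + k) / (L + 3) = i := by
      rw [Nat.add_div_of_dvd_right (Dvd.intro_left _ rfl), Nat.div_eq_of_lt hk]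
      simp
    have h2 : (j * (L + 3) + l) / (L + 3) = j := by
      rw [Nat.add_div_of_dvd_right (Dvd.intro_left _ rfl), Nat.div_eq_of_lt hl]
      simp
    rw [← h1, ← h2, e']
  · refine le_trans ?_ (Set.ncard_le_ncard (hS i hi).2.1 (Set.toFinite _))
    rw [Set.InjOn.ncard_image]
    · have : {k | 2 ≤ k ∧ k < L + 3} = (Finset.Ico 2 (L + 3) : Set ℕ) := by ext; simp
      rw [this, Set.ncard_coe_finset]
      simp
    · intro s hs t ht e
      have := hinj _ _ (hlt i s hi hs.2) (hlt i t hi ht.2) e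
      omega
  · rw [Set.empty_union]
    exact (hS i hi).2.2

end Points

/-! ### Growing a rectangle from two points -/

section Growth

variable {V : Type*} {x y : V → ℤ}

/-- Starting from two points, repeatedly add all points that slice the current rectangle. -/
def grow (x y : V → ℤ) (a b : V) : ℕ → Set V
  | 0 => {a, b}
  | t + 1 => grow x y a b t ∪ {v | Cuts x y v (grow x y a b t)}

theorem grow_mono (a b : V) : Monotone (grow x y a b) :=
  monotone_nat_of_le_succ fun _ => Set.subset_union_left

theorem left_mem_grow (a b : V) (t : ℕ) : a ∈ grow x y a b t :=
  grow_mono a b (Nat.zero_le t) (by simp [grow])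

theorem cuts_of_mem_grow_succ {a b v : V} {t : ℕ} (h : v ∈ grow x y a b (t + 1))
    (h' : v ∉ grow x y a b t) : Cuts x y v (grow x y a b t) :=
  h.resolve_left h'

/-- A point new at some step separates `a` from a point `w` that was new one step before, but sees
all older points alike. Following these predecessors back to `a` and `b` gives the chain; the
membership clause records that the earlier terms are old enough for the induction. -/
theorem exists_isSepChain_of_mem_grow (hx : x.Injective) (hy : y.Injective) {a b : V}
    (hab : a ≠ b) : ∀ (t : ℕ) (c : V), c ∈ grow x y a b (t + 1) → c ∉ grow x y a b t →
    ∃ v : ℕ → V, IsSepChain (relPos x y) v (t + 3) ∧ v (t + 2) = c ∧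
      ∀ i, i ≤ t + 1 → v i ∈ grow x y a b (i - 1)
  | 0, c, h, h' => by
    have hcut := (cuts_iff hx hy h').1 (cuts_of_mem_grow_succ h h')
    have hca : c ≠ a := fun e => h' (by simp [grow, e])
    have hcb : c ≠ b := fun e => h' (by simp [grow, e])
    have hsep : relPos x y c b ≠ relPos x y c a := by
      obtain ⟨p, hp, q, hq, hpq⟩ := hcut
      simp only [grow, Set.mem_insert_iff, Set.mem_singleton_iff] at hp hq
      rcases hp with rfl | rfl <;> rcases hq with rfl | rfl
      · exact absurd rfl hpq
      · exact hpq.symm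
      · exact hpq
      · exact absurd rfl hpq
    refine ⟨fun i => if i = 0 then a else if i = 1 then b else c, ⟨?_, ?_, ?_⟩, by simp, ?_⟩
    · intro i j hij hj
      obtain ⟨rfl, rfl⟩ | ⟨rfl, rfl⟩ | ⟨rfl, rfl⟩ :
        (i = 0 ∧ j = 1) ∨ (i = 0 ∧ j = 2) ∨ (i = 1 ∧ j = 2) := by omega
      · simpa using hab
      · simpa using hca.symm
      · simpa using hcb.symm
    · intro s k hs hk
      obtain ⟨rfl, rfl⟩ : s = 2 ∧ k = 0 := by omega
      simp
    · intro s hs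
      obtain rfl : s = 0 := by omega
      simpa using hsep
    · intro i hi
      obtain rfl | rfl : i = 0 ∨ i = 1 := by omega
      · simp [grow]
      · simp [grow]
  | t + 1, c, h, h' => by
    have hct : c ∉ grow x y a b t := fun e => h' (grow_mono a b (Nat.le_succ t) e)
    have hcut := (cuts_iff hx hy h').1 (cuts_of_mem_grow_succ h h')
    have hncut : ∀ p ∈ grow x y a b t, ∀ q ∈ grow x y a b t,
        relPos x y c p = relPos x y c q := by
      have : ¬ Cuts x y c (grow x y a b t) := fun e => h' (Or.inr e)
      rw [cuts_iff hx hy hct] at this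
      push Not at this
      exact this
    obtain ⟨w, hw, hwa⟩ : ∃ w ∈ grow x y a b (t + 1), relPos x y c w ≠ relPos x y c a := by
      obtain ⟨p, hp, q, hq, hpq⟩ := hcut
      by_cases hpa : relPos x y c p = relPos x y c a
      · exact ⟨q, hq, fun e => hpq (hpa.trans e.symm)⟩
      · exact ⟨p, hp, hpa⟩
    have hwt : w ∉ grow x y a b t := fun e => hwa (hncut w e a (left_mem_grow a b t))
    obtain ⟨v, hv, hvw, hmem⟩ := exists_isSepChain_of_mem_grow hx hy hab t w hw hwt
    have hmem' : ∀ i, i ≤ t + 2 → v i ∈ grow x y a b (t + 1) := fun i hi => by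
      by_cases hi' : i = t + 2
      · rw [hi', hvw]
        exact hw
      · exact grow_mono a b (by omega) (hmem i (by omega))
    have hmemt : ∀ i, i ≤ t + 1 → v i ∈ grow x y a b t := fun i hi =>
      grow_mono a b (by omega) (hmem i (by omega))
    refine ⟨fun i => if i = t + 3 then c else v i, ⟨?_, ?_, ?_⟩, by simp, ?_⟩
    · intro i j hij hj
      simp only [show i ≠ t + 3 by omega, if_false]
      split_ifs with hj'
      · exact fun e => h' (e ▸ hmem' i (by omega))
      · exact hv.ne i j hij (by omega)
    · intro s k hs hk
      simp only [show k ≠ t + 3 by omega, if_false, show 0 ≠ t + 3 by omega]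
      split_ifs with hs'
      · exact hncut _ (hmemt k (by omega)) _ (hmemt 0 (by omega))
      · exact hv.same s k (by omega) hk
    · intro s hs
      simp only [show s + 1 ≠ t + 3 by omega, if_false, show 0 ≠ t + 3 by omega]
      split_ifs with hs'
      · obtain rfl : s = t + 1 := by omega
        rw [hvw, hncut _ (hmemt 0 (by omega)) a (left_mem_grow a b t)]
        exact hwa
      · exact hv.sep s (by omega)
    · intro i hi
      simp only [show i ≠ t + 3 by omega, if_false]
      by_cases hi' : i = t + 2
      · subst hi'
        rw [hvw]
        exact hw
      · exact hmem i (by omega)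

/-- A prime set of points is exhausted by boundedly many growth steps, or it contains a long
chain. -/
theorem hasAlmostDisjointPrimes_or_grow_eq_univ [Finite V] (hx : x.Injective)
    (hy : y.Injective) (hprime : IsPrimeOn (relPos x y) Set.univ) {a b : V} (hab : a ≠ b)
    (L M : ℕ) : HasAlmostDisjointPrimes x y L M ∨ grow x y a b (M * (L + 3)) = Set.univ := by
  by_cases h : grow x y a b (M * (L + 3)) = Set.univ
  · exact Or.inr h
  left
  have hmod : ¬ IsModule (relPos x y) Set.univ (grow x y a b (M * (L + 3))) := by
    intro hm
    rcases hprime _ hm with h1 | h1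
    · exact hab (h1 (left_mem_grow a b _) (grow_mono a b (Nat.zero_le _) (by simp [grow])))
    · exact h h1
  rw [isModule_relPos_iff hx hy] at hmod
  push Not at hmod
  obtain ⟨c, -, hc, hcut⟩ := hmod (Set.subset_univ _)
  obtain ⟨v, hv, -, -⟩ := exists_isSepChain_of_mem_grow hx hy hab _ c (Or.inr hcut) hc
  have := hv.shift 0 (M * (L + 3)) (by omega)
  simp only [zero_add] at this
  exact hasAlmostDisjointPrimes_of_isSepChain hx hy this

end Growth

/-! ### Monotone subsequences -/

section Sequences

theorem exists_sorted_enumeration {α β : Type*} [Nonempty α] [LinearOrder β] (f : α → β)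
    (W : Finset α) (hf : Set.InjOn f W) :
    ∃ s : ℕ → α, (∀ i j, i < j → j < W.card → f (s i) < f (s j)) ∧ ∀ i < W.card, s i ∈ W := by
  have hcard : (W.image f).card = W.card := Finset.card_image_of_injOn hf
  have key : ∀ i, ∃ a : α, ∀ hi : i < W.card,
      a ∈ W ∧ f a = (W.image f).orderEmbOfFin hcard ⟨i, hi⟩ := by
    intro i
    by_cases hi : i < W.card
    · obtain ⟨a, ha, e⟩ := Finset.mem_image.1 (Finset.orderEmbOfFin_mem (W.image f) hcard ⟨i, hi⟩)
      exact ⟨a, fun _ => ⟨ha, e⟩⟩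
    · exact ⟨Classical.arbitrary α, fun h => absurd h hi⟩
  choose s hs using key
  refine ⟨s, fun i j hij hj => ?_, fun i hi => (hs i hi).1⟩
  rw [(hs i (hij.trans hj)).2, (hs j hj).2]
  exact (OrderEmbedding.lt_iff_lt _).2 hij

/-- A qualitative Erdős–Szekeres theorem. -/
theorem exists_strictMonoOn_or_strictAntiOn : ∀ m n : ℕ, ∃ N : ℕ, ∀ (f : ℕ → ℤ) (A : Finset ℕ),
    Set.InjOn f A → N ≤ A.card → (∃ B ⊆ A, B.card = m ∧ StrictMonoOn f B) ∨
      ∃ B ⊆ A, B.card = n ∧ StrictAntiOn f B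
  | 0, n => ⟨0, fun f A _ _ => Or.inl ⟨∅, by simp, by simp, by simp [StrictMonoOn]⟩⟩
  | m + 1, 0 => ⟨0, fun f A _ _ => Or.inr ⟨∅, by simp, by simp, by simp [StrictAntiOn]⟩⟩
  | m + 1, n + 1 => by
    obtain ⟨N₁, h₁⟩ := exists_strictMonoOn_or_strictAntiOn m (n + 1)
    obtain ⟨N₂, h₂⟩ := exists_strictMonoOn_or_strictAntiOn (m + 1) n
    refine ⟨N₁ + N₂ + 1, fun f A hf hA => ?_⟩
    have hne : A.Nonempty := Finset.card_pos.1 (by omega)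
    set a := A.min' hne with ha
    have haA : a ∈ A := A.min'_mem hne
    have hlt : ∀ i ∈ A.erase a, a < i := fun i hi => by
      rw [Finset.mem_erase] at hi
      exact lt_of_le_of_ne (A.min'_le i hi.2) hi.1.symm
    have hcard := Finset.card_filter_add_card_filter_not (s := A.erase a) (fun i => f a < f i)
    rw [Finset.card_erase_of_mem haA] at hcard
    have hsub : ∀ p : ℕ → Prop, ∀ [DecidablePred p], (A.erase a).filter p ⊆ A := fun p _ =>
      (Finset.filter_subset _ _).trans (Finset.erase_subset _ _)
    by_cases hc : N₁ ≤ ((A.erase a).filter fun i => f a < f i).card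
    · rcases h₁ f _ (hf.mono (by exact_mod_cast hsub _)) hc with ⟨B, hB, hBc, hBm⟩ | ⟨B, hB, h⟩
      · left
        have haB : a ∉ B := fun h => by simpa using hB h
        refine ⟨insert a B, Finset.insert_subset haA (hB.trans (hsub _)), by simp [haB, hBc], ?_⟩
        intro i hi j hj hij
        simp only [Finset.coe_insert, Set.mem_insert_iff, Finset.mem_coe] at hi hj
        rcases hi with rfl | hi <;> rcases hj with rfl | hj
        · exact absurd hij (lt_irrefl _)
        · exact (Finset.mem_filter.1 (hB hj)).2
        · exact absurd (hlt i (Finset.mem_filter.1 (hB hi)).1) (not_lt.2 hij.le)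
        · exact hBm hi hj hij
      · exact Or.inr ⟨B, hB.trans (hsub _), h⟩
    · rcases h₂ f ((A.erase a).filter fun i => ¬ f a < f i)
        (hf.mono (by exact_mod_cast hsub _)) (by omega) with ⟨B, hB, h⟩ | ⟨B, hB, hBc, hBm⟩
      · exact Or.inl ⟨B, hB.trans (hsub _), h⟩
      · right
        have haB : a ∉ B := fun h => by simpa using hB h
        refine ⟨insert a B, Finset.insert_subset haA (hB.trans (hsub _)), by simp [haB, hBc], ?_⟩
        intro i hi j hj hij
        simp only [Finset.coe_insert, Set.mem_insert_iff, Finset.mem_coe] at hi hj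
        rcases hi with rfl | hi <;> rcases hj with rfl | hj
        · exact absurd hij (lt_irrefl _)
        · have hj' := Finset.mem_filter.1 (hB hj)
          refine lt_of_le_of_ne (not_lt.1 hj'.2) fun e => ?_
          have := hf (by exact_mod_cast hsub _ (hB hj)) (by exact_mod_cast haA) e
          exact hij.ne this.symm
        · exact absurd (hlt i (Finset.mem_filter.1 (hB hi)).1) (not_lt.2 hij.le)
        · exact hBm hi hj hij

/-- The first `m` terms of `f` are increasing. -/
def IncreasesBelow (f : ℕ → ℤ) (m : ℕ) : Prop := ∀ i j, i < j → j < m → f i < f j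

theorem IncreasesBelow.comp {f : ℕ → ℤ} {m n : ℕ} {s : ℕ → ℕ} (hf : IncreasesBelow f m)
    (hs : ∀ i j, i < j → j < n → s i < s j) (hsm : ∀ i < n, s i < m) :
    IncreasesBelow (f ∘ s) n :=
  fun i j hij hj => hf _ _ (hs i j hij hj) (hsm j hj)

theorem exists_monotone_subsequence (m : ℕ) : ∃ N : ℕ, ∀ f : ℕ → ℤ,
    Set.InjOn f {i | i < N} → ∃ s : ℕ → ℕ, (∀ i j, i < j → j < m → s i < s j) ∧
      (∀ i < m, s i < N) ∧
        (IncreasesBelow (f ∘ s) m ∨ IncreasesBelow (fun i => -(f ∘ s) i) m) := by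
  obtain ⟨N, hN⟩ := exists_strictMonoOn_or_strictAntiOn m m
  refine ⟨N, fun f hf => ?_⟩
  rcases hN f (Finset.range N) (hf.mono fun i hi => by simpa using hi) (by simp) with
    ⟨B, hB, rfl, hm⟩ | ⟨B, hB, rfl, hm⟩
  all_goals
    obtain ⟨s, hs, hsB⟩ := exists_sorted_enumeration id B (Set.injOn_id _)
    refine ⟨s, hs, fun i hi => Finset.mem_range.1 (hB (hsB i hi)), ?_⟩
  · exact Or.inl fun i j hij hj => hm (hsB i (hij.trans hj)) (hsB j hj) (hs i j hij hj)
  · exact Or.inr fun i j hij hj =>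
      neg_lt_neg (hm (hsB i (hij.trans hj)) (hsB j hj) (hs i j hij hj))

end Sequences

/-! ### Alternations and how they arise from highest slicing points -/

section Alternations

variable {V : Type*} {x y : V → ℤ}

/-- From left to right the points are `u 0, d 0, u 1, d 1, …, u (m - 1), d (m - 1)`, and every `u`
lies above every `d`. -/
structure IsAlternation (x y : V → ℤ) (u d : ℕ → V) (m : ℕ) : Prop where
  ud : ∀ i j, i ≤ j → j < m → x (u i) < x (d j)
  du : ∀ i j, i < j → j < m → x (d i) < x (u j)
  below : ∀ i j, i < m → j < m → y (d i) < y (u j)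

theorem IsAlternation.comp {u d : ℕ → V} {m n : ℕ} {s : ℕ → ℕ} (h : IsAlternation x y u d m)
    (hs : ∀ i j, i < j → j < n → s i < s j) (hsm : ∀ i < n, s i < m) :
    IsAlternation x y (u ∘ s) (d ∘ s) n where
  ud i j hij hj := h.ud _ _ (by
    rcases hij.eq_or_lt with rfl | hlt
    · exact le_rfl
    · exact (hs i j hlt hj).le) (hsm j hj)
  du i j hij hj := h.du _ _ (hs i j hij hj) (hsm j hj)
  below i j hi hj := h.below _ _ (hsm i hi) (hsm j hj)

theorem IsAlternation.uu {u d : ℕ → V} {m i j : ℕ} (h : IsAlternation x y u d m) (hij : i < j)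
    (hj : j < m) : x (u i) < x (u j) :=
  (h.ud i i le_rfl (hij.trans hj)).trans (h.du i j hij hj)

theorem IsAlternation.dd {u d : ℕ → V} {m i j : ℕ} (h : IsAlternation x y u d m) (hij : i < j)
    (hj : j < m) : x (d i) < x (d j) :=
  (h.du i j hij hj).trans (h.ud j j le_rfl hj)

theorem IsAlternation.exists_monotone (m : ℕ) : ∃ N : ℕ, ∀ {V : Type} {x y : V → ℤ}
    {u d : ℕ → V}, y.Injective → IsAlternation x y u d N → ∃ u' d', IsAlternation x y u' d' m ∧
      (IncreasesBelow (y ∘ u') m ∨ IncreasesBelow (fun i => -y (u' i)) m) ∧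
      (IncreasesBelow (y ∘ d') m ∨ IncreasesBelow (fun i => -y (d' i)) m) := by
  obtain ⟨N, hN⟩ := exists_monotone_subsequence m
  obtain ⟨K, hK⟩ := exists_monotone_subsequence N
  have inj : ∀ {V : Type} {x y : V → ℤ} (f : ℕ → V) (n : ℕ), y.Injective →
      (∀ i j, i < j → j < n → x (f i) < x (f j)) → Set.InjOn (y ∘ f) {i | i < n} := by
    intro V x y f n hy hf i hi j hj e
    by_contra hne
    have e' : f i = f j := hy e
    rcases Nat.lt_or_gt_of_ne hne with hlt | hlt
    · exact (hf i j hlt hj).ne (by rw [e'])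
    · exact (hf j i hlt hi).ne (by rw [e'])
  refine ⟨K, fun {V x y u d} hy h => ?_⟩
  obtain ⟨s, hs, hsK, hsm⟩ := hK (y ∘ u) (inj u K hy fun i j hij hj => h.uu hij hj)
  have h' := h.comp hs hsK
  obtain ⟨s', hs', hsN, hsm'⟩ := hN (y ∘ d ∘ s) (inj (d ∘ s) N hy fun i j hij hj => h'.dd hij hj)
  refine ⟨(u ∘ s) ∘ s', (d ∘ s) ∘ s', h'.comp hs' hsN, ?_, hsm'⟩
  rcases hsm with hsm | hsm
  · exact Or.inl (hsm.comp hs' hsN)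
  · exact Or.inr (hsm.comp hs' hsN)

/-- Points above the horizontal line at height `h`, each being the highest point that slices
horizontally its own set of points below the line, give rise to an alternation. -/
theorem exists_isAlternation_of_highest (hx : x.Injective) {h : ℤ} {m : ℕ} (W : Finset V)
    (hW : m < W.card) (P : V → Set V) (hup : ∀ w ∈ W, h ≤ y w)
    (hdown : ∀ w ∈ W, ∀ r ∈ P w, y r < h)
    (hcut : ∀ w ∈ W, ∃ p ∈ P w, ∃ q ∈ P w, x p < x w ∧ x w < x q)
    (hmax : ∀ w ∈ W, ∀ w' ∈ W, y w < y w' → ∀ p ∈ P w, ∀ q ∈ P w, x p < x w' → ¬ x w' < x q)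
    (hy : y.Injective) :
    ∃ u d, IsAlternation x y u d m := by
  have hne : W.Nonempty := Finset.card_pos.1 (by omega)
  have : Nonempty V := hne.to_type
  obtain ⟨s, hs, hsW⟩ := exists_sorted_enumeration x W hx.injOn
  -- The set attached to the lower of the two points straddles it horizontally but does not reach
  -- past the higher one, so one of its members lies between them.
  have key : ∀ w ∈ W, ∀ w' ∈ W, x w < x w' → ∃ p, y p < h ∧ x w < x p ∧ x p < x w' := by
    intro w hw w' hw' hlt
    have hneq : y w ≠ y w' := hy.ne fun e => hlt.ne (by rw [e])
    have hxne : ∀ p, y p < h → x p ≠ x w ∧ x p ≠ x w' := fun p hp =>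
      ⟨hx.ne fun e => by have := hup w hw; rw [e] at hp; omega,
        hx.ne fun e => by have := hup w' hw'; rw [e] at hp; omega⟩
    rcases Int.lt_or_gt_of_ne hneq with hyy | hyy
    · obtain ⟨p, hp, q, hq, h1, h2⟩ := hcut w hw
      have h3 := hmax w hw w' hw' hyy p hp q hq (h1.trans hlt)
      have h4 := hxne q (hdown w hw q hq)
      exact ⟨q, hdown w hw q hq, h2, by omega⟩
    · obtain ⟨p, hp, q, hq, h1, h2⟩ := hcut w' hw'
      have h3 := hmax w' hw' w hw hyy p hp q hq
      have h4 := hxne p (hdown w' hw' p hp)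
      exact ⟨p, hdown w' hw' p hp, by omega, h1⟩
  have key' : ∀ i, ∃ p, i < m → y p < h ∧ x (s i) < x p ∧ x p < x (s (i + 1)) := by
    intro i
    by_cases hi : i < m
    · obtain ⟨p, hp⟩ := key _ (hsW i (by omega)) _ (hsW (i + 1) (by omega))
        (hs i (i + 1) (by omega) (by omega))
      exact ⟨p, fun _ => hp⟩
    · exact ⟨s 0, fun h => absurd h hi⟩
  choose d hd using key'
  refine ⟨s, d, ⟨fun i j hij hj => ?_, fun i j hij hj => ?_, fun i j hi hj => ?_⟩⟩
  · refine lt_of_le_of_lt ?_ (hd j hj).2.1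
    rcases hij.eq_or_lt with rfl | hlt
    · exact le_rfl
    · exact (hs i j hlt (by omega)).le
  · refine lt_of_lt_of_le (hd i (by omega)).2.2 ?_
    rcases (show i + 1 ≤ j from hij).eq_or_lt with rfl | hlt
    · exact le_rfl
    · exact (hs _ j hlt (by omega)).le
  · exact lt_of_lt_of_le (hd i hi).1 (hup _ (hsW j (by omega)))

/-- Data exhibiting `w` as the highest point of `Q`, separated by `c` from `P ⊆ Q`. -/
structure IsSeparatedTop (x y : V → ℤ) (c : V) (P Q : Set V) (w : V) : Prop where
  mem : w ∈ Q
  le : ∀ r ∈ Q, y r ≤ y w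
  lt : y c < y w
  below : ∀ r ∈ P, y r < y c

/-- Pigeonhole on `w`: some value has a large fiber, or there are more than `m` values. In the
latter case each top, lying above all of `P j`, must slice it horizontally, and nothing higher does,
since that would belong to `Q j`. The line is drawn at the height of `c`. -/
theorem exists_isAlternation_or_fiber (hx : x.Injective) (hy : y.Injective) {c : V} {m B : ℕ}
    (J : Finset ℕ) (P Q : ℕ → Set V) (w : ℕ → V) (hQ : ∀ j v, Cuts x y v (P j) → v ∈ Q j)
    (hQ' : ∀ j, ∀ v ∈ Q j, v ∉ P j → Cuts x y v (P j))
    (hw : ∀ j ∈ J, IsSeparatedTop x y c (P j) (Q j) (w j)) (hJ : B * m < J.card) :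
    (∃ u d, IsAlternation x y u d m) ∨ ∃ v, ∃ J' ⊆ J, B < J'.card ∧ ∀ j ∈ J', w j = v := by
  classical
  by_cases hf : ∃ v ∈ J.image w, B < (J.filter fun j => w j = v).card
  · obtain ⟨v, -, hv⟩ := hf
    exact Or.inr ⟨v, _, Finset.filter_subset _ _, hv, fun j hj => (Finset.mem_filter.1 hj).2⟩
  left
  push Not at hf
  have hcard : m < (J.image w).card := by
    have h1 := Finset.card_le_mul_card_image J B hf
    by_contra hcon
    have := Nat.mul_le_mul_left B (not_lt.1 hcon)
    omega
  have hk : ∀ v, ∃ j, v ∈ J.image w → j ∈ J ∧ w j = v := fun v => by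
    by_cases hv : v ∈ J.image w
    · obtain ⟨j, hj, e⟩ := Finset.mem_image.1 hv
      exact ⟨j, fun _ => ⟨hj, e⟩⟩
    · exact ⟨0, fun h => absurd h hv⟩
  choose k hk using hk
  have hw' : ∀ v ∈ J.image w, IsSeparatedTop x y c (P (k v)) (Q (k v)) v := fun v hv => by
    have := hw _ (hk v hv).1
    rwa [(hk v hv).2] at this
  refine exists_isAlternation_of_highest hx (h := y c) (J.image w) hcard (fun v => P (k v))
    (fun v hv => (hw' v hv).lt.le) (fun v hv => (hw' v hv).below) (fun v hv => ?_)
    (fun v hv v' hv' hlt p hp q hq h1 h2 => ?_) hy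
  · have hP : v ∉ P (k v) := fun e => ((hw' v hv).below v e).not_gt (hw' v hv).lt
    rcases hQ' _ v (hw' v hv).mem hP with h | ⟨a, ha, b, hb, h1, h2⟩
    · exact h
    · have := (hw' v hv).below b hb
      have := (hw' v hv).lt
      omega
  · exact hlt.not_ge ((hw' v hv).le v' (hQ _ v' (Or.inl ⟨p, hp, q, hq, h1, h2⟩)))

end Alternations

/-! ### Many growth processes meeting in one point -/

section Convergence

/-- An alternation in one of four orientations. -/
def HasAlternation {V : Type*} (x y : V → ℤ) (m : ℕ) : Prop :=
  (∃ u d, IsAlternation x y u d m) ∨ (∃ u d, IsAlternation x (fun v => -y v) u d m) ∨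
  (∃ u d, IsAlternation y x u d m) ∨ ∃ u d, IsAlternation y (fun v => -x v) u d m

/-- As `c` does not slice `P` vertically, `P` lies on one side of the horizontal line through `c`;
the extreme point of `Q` on the other side is the required top, up to reflection. -/
theorem exists_isSeparatedTop {V : Type*} [Finite V] {x y : V → ℤ} {c : V} {P Q : Set V}
    (hPQ : P ⊆ Q) (hP : P.Nonempty) (hcP : ∀ r ∈ P, y r ≠ y c)
    (hn : ¬ ∃ a ∈ P, ∃ b ∈ P, y a < y c ∧ y c < y b)
    (hc : ∃ a ∈ Q, ∃ b ∈ Q, y a < y c ∧ y c < y b) :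
    (∃ w, IsSeparatedTop x y c P Q w) ∨ ∃ w, IsSeparatedTop x (fun v => -y v) c P Q w := by
  obtain ⟨a, ha, b, hb, hac, hcb⟩ := hc
  obtain ⟨r, hr⟩ := hP
  rcases Int.lt_or_gt_of_ne (hcP r hr) with h | h
  · left
    obtain ⟨w, hw, hle⟩ := Set.exists_max_image Q y (Set.toFinite _) ⟨r, hPQ hr⟩
    refine ⟨w, hw, hle, hcb.trans_le (hle b hb), fun s hs => ?_⟩
    by_contra hcon
    exact hn ⟨r, hr, s, hs, h, by have := hcP s hs; omega⟩
  · right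
    obtain ⟨w, hw, hle⟩ := Set.exists_min_image Q y (Set.toFinite _) ⟨r, hPQ hr⟩
    refine ⟨w, hw, fun s hs => neg_le_neg (hle s hs),
      neg_lt_neg ((hle a ha).trans_lt hac), fun s hs => ?_⟩
    by_contra hcon
    beta_reduce at hcon
    exact hn ⟨s, hs, r, hr, by have := hcP s hs; omega, h⟩

/-- The vertical line through `c` meets the span of at most one pair, so all other pairs straddle
the horizontal line through `c`. Upper points of every second pair and lower points of the remaining
ones alternate. -/
theorem hasAlternation_of_slices_pairs {V : Type*} {x y : V → ℤ} {a b : ℕ → V}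
    {c : V} {m : ℕ} (J : Finset ℕ)
    (hab : ∀ j ∈ J, x (a j) < x (b j))
    (hba : ∀ i ∈ J, ∀ j ∈ J, i < j → x (b i) < x (a j))
    (hcut : ∀ j ∈ J, Cuts x y c {a j, b j}) (hJ : 2 * m < J.card) :
    ∃ u d, IsAlternation x y u d m := by
  classical
  set J' := J.filter fun j => ∃ p ∈ ({a j, b j} : Set V), ∃ q ∈ ({a j, b j} : Set V),
    y p < y c ∧ y c < y q with hJ'
  have hx : ∀ j ∈ J, ∀ p ∈ ({a j, b j} : Set V), x (a j) ≤ x p ∧ x p ≤ x (b j) := by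
    rintro j hj p (rfl | rfl)
    · exact ⟨le_rfl, (hab j hj).le⟩
    · exact ⟨(hab j hj).le, le_rfl⟩
  have hlt : ∀ i ∈ J, ∀ j ∈ J, i < j → ∀ p ∈ ({a i, b i} : Set V),
      ∀ q ∈ ({a j, b j} : Set V), x p < x q := fun i hi j hj hij p hp q hq =>
    (hx i hi p hp).2.trans_lt ((hba i hi j hj hij).trans_le (hx j hj q hq).1)
  have hcard : 2 * m ≤ J'.card := by
    have h1 := Finset.card_filter_add_card_filter_not (s := J)
      (fun j => ∃ p ∈ ({a j, b j} : Set V), ∃ q ∈ ({a j, b j} : Set V), y p < y c ∧ y c < y q)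
    have h2 : (J.filter fun j => ¬ ∃ p ∈ ({a j, b j} : Set V), ∃ q ∈ ({a j, b j} : Set V),
        y p < y c ∧ y c < y q).card ≤ 1 := by
      rw [Finset.card_le_one]
      have : ∀ i ∈ J.filter fun j => ¬ ∃ p ∈ ({a j, b j} : Set V), ∃ q ∈ ({a j, b j} : Set V),
          y p < y c ∧ y c < y q, ∃ p ∈ ({a i, b i} : Set V), ∃ q ∈ ({a i, b i} : Set V),
          x p < x c ∧ x c < x q := fun i hi => by
        rw [Finset.mem_filter] at hi
        exact (hcut i hi.1).resolve_right hi.2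
      intro i hi j hj
      obtain ⟨p, hp, q, hq, h3, h4⟩ := this i hi
      obtain ⟨p', hp', q', hq', h5, h6⟩ := this j hj
      by_contra hne
      rcases Nat.lt_or_gt_of_ne hne with h | h
      · have := hlt i (Finset.mem_filter.1 hi).1 j (Finset.mem_filter.1 hj).1 h q hq p' hp'
        omega
      · have := hlt j (Finset.mem_filter.1 hj).1 i (Finset.mem_filter.1 hi).1 h q' hq' p hp
        omega
    rw [← hJ'] at h1
    omega
  obtain ⟨s, hs, hsJ⟩ := exists_sorted_enumeration id J' (Set.injOn_id _)
  have key : ∀ i, ∃ p q, i < J'.card → p ∈ ({a (s i), b (s i)} : Set V) ∧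
      q ∈ ({a (s i), b (s i)} : Set V) ∧ y p < y c ∧ y c < y q := by
    intro i
    by_cases hi : i < J'.card
    · obtain ⟨p, hp, q, hq, h⟩ := (Finset.mem_filter.1 (hsJ i hi)).2
      exact ⟨p, q, fun _ => ⟨hp, hq, h⟩⟩
    · exact ⟨c, c, fun h => absurd h hi⟩
  choose p q hpq using key
  have hsJ' : ∀ i < J'.card, s i ∈ J := fun i hi => (Finset.mem_filter.1 (hsJ i hi)).1
  refine ⟨fun i => q (2 * i), fun i => p (2 * i + 1), ⟨fun i j hij hj => ?_,
    fun i j hij hj => ?_, fun i j hi hj => ?_⟩⟩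
  · exact hlt _ (hsJ' _ (by omega)) _ (hsJ' _ (by omega)) (hs (2 * i) (2 * j + 1) (by omega) (by omega))
      _ (hpq _ (by omega)).2.1 _
      (hpq _ (by omega)).1
  · exact hlt _ (hsJ' _ (by omega)) _ (hsJ' _ (by omega)) (hs (2 * i + 1) (2 * j) (by omega) (by omega))
      _ (hpq _ (by omega)).1 _
      (hpq _ (by omega)).2.1
  · exact (hpq (2 * i + 1) (by omega)).2.2.1.trans (hpq (2 * j) (by omega)).2.2.2

/-- Many growth processes with horizontally disjoint starting pairs that reach a common point in
the same step produce a long alternation. -/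
theorem hasAlternation_of_common_level (m : ℕ) : ∀ t : ℕ, ∃ K : ℕ, ∀ {V : Type} [Finite V]
    {x y : V → ℤ}, x.Injective → y.Injective → ∀ {a b : ℕ → V},
    ∀ (J : Finset ℕ) (c : V), (∀ j ∈ J, x (a j) < x (b j)) →
    (∀ i ∈ J, ∀ j ∈ J, i < j → x (b i) < x (a j)) → (∀ j ∈ J, c ∈ grow x y (a j) (b j) t ∧
      ∀ s < t, c ∉ grow x y (a j) (b j) s) → K < J.card → HasAlternation x y m
  | 0 => by
    refine ⟨1, fun {V _ x y} hx hy {a b} J c hab hba hJ hcard => ?_⟩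
    obtain ⟨i, hi, j, hj, hne⟩ := Finset.one_lt_card.1 hcard
    have hc : ∀ j ∈ J, x (a j) ≤ x c ∧ x c ≤ x (b j) := fun j hj => by
      rcases (hJ j hj).1 with e | e
      · rw [e]
        exact ⟨le_rfl, (hab j hj).le⟩
      · rw [Set.mem_singleton_iff.1 e]
        exact ⟨(hab j hj).le, le_rfl⟩
    have h1 := hc i hi
    have h2 := hc j hj
    rcases Nat.lt_or_gt_of_ne hne with h | h
    · have := hba _ ‹_› _ ‹_› h
      omega
    · have := hba _ ‹_› _ ‹_› h
      omega
  | 1 => ⟨2 * m, fun {V _ x y} hx hy {a b} J c hab hba hJ hcard =>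
      Or.inl (hasAlternation_of_slices_pairs J hab hba (fun j hj =>
        cuts_of_mem_grow_succ (hJ j hj).1 ((hJ j hj).2 0 one_pos)) hcard)⟩
  | t + 2 => by
    obtain ⟨B, hB⟩ := hasAlternation_of_common_level m (t + 1)
    -- One allowance of `B * m` for each of the four directions in which the separated top may lie.
    refine ⟨4 * (B * m), fun {V _ x y} hx hy {a b} J c hab hba hJ hcard => ?_⟩
    classical
    set P : ℕ → Set V := fun j => grow x y (a j) (b j) t with hP
    set Q : ℕ → Set V := fun j => grow x y (a j) (b j) (t + 1) with hQ
    have hPQ : ∀ j, P j ⊆ Q j := fun j => grow_mono _ _ (Nat.le_succ t)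
    have hx' := neg_comp_injective hx
    have hy' := neg_comp_injective hy
    have hdir : ∀ j ∈ J, ((∃ w, IsSeparatedTop x y c (P j) (Q j) w) ∨
        ∃ w, IsSeparatedTop x (fun v => -y v) c (P j) (Q j) w) ∨
        ((∃ w, IsSeparatedTop y x c (P j) (Q j) w) ∨
        ∃ w, IsSeparatedTop y (fun v => -x v) c (P j) (Q j) w) := by
      intro j hj
      have hcQ : c ∉ Q j := (hJ j hj).2 (t + 1) (by omega)
      have hcut : Cuts x y c (Q j) := cuts_of_mem_grow_succ (hJ j hj).1 hcQ
      have hncut : ¬ Cuts x y c (P j) := fun e => hcQ (Or.inr e)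
      have hne : ∀ r ∈ P j, r ≠ c := fun r hr e => hcQ (hPQ j (e ▸ hr))
      have hPn : (P j).Nonempty := ⟨a j, left_mem_grow _ _ _⟩
      rw [Cuts, not_or] at hncut
      rcases hcut with h | h
      · exact Or.inr (exists_isSeparatedTop (hPQ j) hPn (fun r hr => hx.ne (hne r hr)) hncut.1 h)
      · exact Or.inl (exists_isSeparatedTop (hPQ j) hPn (fun r hr => hy.ne (hne r hr)) hncut.2 h)
    -- A top shared by more than `B` processes lies in `Q j` but beyond `c`, hence not in `P j`: it
    -- is first reached at step `t + 1` exactly, and the induction hypothesis applies to it.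
    have hfib : ∀ {x' y' : V → ℤ} (w : ℕ → V) (J' : Finset ℕ), J' ⊆ J →
        (∀ j ∈ J', IsSeparatedTop x' y' c (P j) (Q j) (w j)) →
        (∃ v, ∃ J'' ⊆ J', B < J''.card ∧ ∀ j ∈ J'', w j = v) → HasAlternation x y m := by
      rintro x' y' w J' hJ' hw ⟨v, J'', hJ'', hc'', he⟩
      have hsub : ∀ j ∈ J'', j ∈ J := fun j hj => hJ' (hJ'' hj)
      refine hB hx hy J'' v (fun j hj => hab j (hsub j hj))
        (fun i hi j hj => hba i (hsub i hi) j (hsub j hj)) (fun j hj => ?_) hc''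
      have hw' := hw j (hJ'' hj)
      rw [he j hj] at hw'
      refine ⟨hw'.mem, fun s hs hvs => ?_⟩
      have := hw'.below v (grow_mono _ _ (Nat.lt_succ_iff.1 hs) hvs)
      have := hw'.lt
      omega
    have hstep : ∀ {x' y' : V → ℤ}, x'.Injective → y'.Injective →
        (∀ v A, Cuts x' y' v A ↔ Cuts x y v A) →
        B * m < (J.filter fun j => ∃ w, IsSeparatedTop x' y' c (P j) (Q j) w).card →
        (∃ u d, IsAlternation x' y' u d m) ∨ HasAlternation x y m := by
      intro x' y' hxi hyi hcuts hlt
      have key : ∀ j, ∃ w, (j ∈ J.filter fun j => ∃ w, IsSeparatedTop x' y' c (P j) (Q j) w) →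
          IsSeparatedTop x' y' c (P j) (Q j) w := fun j => by
        by_cases hj : j ∈ J.filter fun j => ∃ w, IsSeparatedTop x' y' c (P j) (Q j) w
        · obtain ⟨w, hw⟩ := (Finset.mem_filter.1 hj).2
          exact ⟨w, fun _ => hw⟩
        · exact ⟨c, fun h => absurd h hj⟩
      choose w hw using key
      refine (exists_isAlternation_or_fiber hxi hyi _ P Q w
        (fun j v hv => Or.inr ((hcuts _ _).1 hv))
        (fun j v hv hv' => (hcuts _ _).2 (cuts_of_mem_grow_succ hv hv')) hw hlt).imp_right
        (hfib w _ (Finset.filter_subset _ _) hw)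
    have hcover : J.card ≤
        (J.filter fun j => ∃ w, IsSeparatedTop x y c (P j) (Q j) w).card +
        (J.filter fun j => ∃ w, IsSeparatedTop x (fun v => -y v) c (P j) (Q j) w).card +
        (J.filter fun j => ∃ w, IsSeparatedTop y x c (P j) (Q j) w).card +
        (J.filter fun j => ∃ w, IsSeparatedTop y (fun v => -x v) c (P j) (Q j) w).card := by
      refine le_trans (Finset.card_le_card fun j hj => ?_)
        ((Finset.card_union_le _ _).trans (Nat.add_le_add_right ((Finset.card_union_le _ _).trans
          (Nat.add_le_add_right (Finset.card_union_le _ _) _)) _))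
      have := hdir j hj
      simp only [Finset.mem_union, Finset.mem_filter]
      tauto
    by_cases h1 : B * m < (J.filter fun j => ∃ w, IsSeparatedTop x y c (P j) (Q j) w).card
    · exact (hstep hx hy (fun _ _ => Iff.rfl) h1).elim Or.inl id
    by_cases h2 : B * m <
        (J.filter fun j => ∃ w, IsSeparatedTop x (fun v => -y v) c (P j) (Q j) w).card
    · exact (hstep hx hy' (fun _ _ => cuts_neg) h2).elim (fun h => Or.inr (Or.inl h)) id
    by_cases h3 : B * m < (J.filter fun j => ∃ w, IsSeparatedTop y x c (P j) (Q j) w).card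
    · exact (hstep hy hx (fun _ _ => cuts_swap) h3).elim
        (fun h => Or.inr (Or.inr (Or.inl h))) id
    · exact (hstep hy hx' (fun _ _ => cuts_neg.trans cuts_swap) (by omega)).elim
        (fun h => Or.inr (Or.inr (Or.inr h))) id

end Convergence

/-! ### Prime sets made of consecutive layers -/

section Layers

variable {V : Type*} {x y : V → ℤ} {u d : ℕ → V} {n : ℕ}

/-- The points of the first `n` layers of an alternation. -/
def layers (u d : ℕ → V) (n : ℕ) : Set V := {v | ∃ i < n, v = u i ∨ v = d i}

theorem upper_mem_layers {i : ℕ} (hi : i < n) : u i ∈ layers u d n := ⟨i, hi, Or.inl rfl⟩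

theorem lower_mem_layers {i : ℕ} (hi : i < n) : d i ∈ layers u d n := ⟨i, hi, Or.inr rfl⟩

/-- Two upper points have a lower point horizontally between them, and vice versa. -/
theorem IsAlternation.exists_upper_lower (h : IsAlternation x y u d n) {A S : Set V}
    (hS : layers u d n ⊆ S)
    (hA : ∀ v ∈ S, ∀ a ∈ A, ∀ b ∈ A, x a < x v → x v < x b → v ∈ A) {p q : V}
    (hp : p ∈ A) (hq : q ∈ A) (hpq : p ≠ q) (hp' : p ∈ layers u d n) (hq' : q ∈ layers u d n) :
    ∃ i < n, ∃ j < n, u i ∈ A ∧ d j ∈ A := by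
  have huu : ∀ i j, i < j → j < n → u i ∈ A → u j ∈ A → d i ∈ A := fun i j hij hj h1 h2 =>
    hA _ (hS (lower_mem_layers (hij.trans hj))) _ h1 _ h2 (h.ud i i le_rfl (hij.trans hj))
      (h.du i j hij hj)
  have hdd : ∀ i j, i < j → j < n → d i ∈ A → d j ∈ A → u j ∈ A := fun i j hij hj h1 h2 =>
    hA _ (hS (upper_mem_layers hj)) _ h1 _ h2 (h.du i j hij hj) (h.ud j j le_rfl hj)
  obtain ⟨i, hi, rfl | rfl⟩ := hp' <;> obtain ⟨j, hj, rfl | rfl⟩ := hq'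
  · rcases Nat.lt_trichotomy i j with hij | rfl | hij
    · exact ⟨i, hi, i, hi, hp, huu i j hij hj hp hq⟩
    · exact absurd rfl hpq
    · exact ⟨i, hi, j, hj, hp, huu j i hij hi hq hp⟩
  · exact ⟨i, hi, j, hj, hp, hq⟩
  · exact ⟨j, hj, i, hi, hq, hp⟩
  · rcases Nat.lt_trichotomy i j with hij | rfl | hij
    · exact ⟨j, hj, i, hi, hdd i j hij hj hp hq, hp⟩
    · exact absurd rfl hpq
    · exact ⟨i, hi, i, hi, hdd j i hij hi hq hp, hp⟩

/-- Vertical convexity pulls in the lowest upper point `u 0` and the highest lower point `d (n -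
1)`. These are also the leftmost and rightmost points, so everything follows. -/
theorem isPrimeOn_layers_of_parallel (hx : x.Injective) (hy : y.Injective)
    (h : IsAlternation x y u d n) (hu : IncreasesBelow (y ∘ u) n)
    (hd : IncreasesBelow (y ∘ d) n) : IsPrimeOn (relPos x y) (layers u d n) := by
  refine isPrimeOn_of_forall_closed hx hy fun A hA hcx hcy p hp q hq hpq => ?_
  obtain ⟨i, hi, j, hj, hui, hdj⟩ :=
    h.exists_upper_lower subset_rfl hcx hp hq hpq (hA hp) (hA hq)
  have h0 : u 0 ∈ A := by
    rcases Nat.eq_zero_or_pos i with rfl | hi0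
    · exact hui
    · exact hcy _ (upper_mem_layers (by omega)) _ hdj _ hui (h.below _ _ hj (by omega))
        (hu 0 i hi0 hi)
  have h1 : d (n - 1) ∈ A := by
    by_cases hjn : j = n - 1
    · exact hjn ▸ hdj
    · exact hcy _ (lower_mem_layers (by omega)) _ hdj _ hui (hd j (n - 1) (by omega) (by omega))
        (h.below _ _ (by omega) hi)
  rintro _ ⟨k, hk, rfl | rfl⟩
  · rcases Nat.eq_zero_or_pos k with rfl | hk0
    · exact h0
    · exact hcx _ (upper_mem_layers hk) _ h0 _ h1 (h.uu hk0 hk) (h.ud _ _ (by omega) (by omega))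
  · by_cases hkn : k = n - 1
    · exact hkn ▸ h1
    · exact hcx _ (lower_mem_layers hk) _ h0 _ h1 (h.ud _ _ (by omega) hk)
        (h.dd (by omega) (by omega))

/-- The point `v` sits in the mouth of the wedge, at its left. With any upper point it forces the
innermost `u (n - 1)`, then horizontally all but `d (n - 1)`, which lies vertically between `d 0`
and `v`; this needs two layers. -/
theorem isPrimeOn_layers_of_mouth (hx : x.Injective) (hy : y.Injective) (hn : 2 ≤ n)
    (h : IsAlternation x y u d n) (hu : IncreasesBelow (fun i => -y (u i)) n)
    (hd : IncreasesBelow (y ∘ d) n) {v : V} (hvx : x v < x (u 0))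
    (hvd : ∀ i < n, y (d i) < y v) (hvu : ∀ i < n, y v < y (u i)) :
    IsPrimeOn (relPos x y) ({v} ∪ layers u d n) := by
  refine isPrimeOn_of_forall_closed hx hy fun A hA hcx hcy p hp q hq hpq => ?_
  have hU : ∀ i < n, u i ∈ {v} ∪ layers u d n := fun i hi => Or.inr (upper_mem_layers hi)
  have hD : ∀ i < n, d i ∈ {v} ∪ layers u d n := fun i hi => Or.inr (lower_mem_layers hi)
  have hvxu : ∀ i < n, x v < x (u i) := fun i hi => by
    rcases Nat.eq_zero_or_pos i with rfl | hi0
    · exact hvx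
    · exact hvx.trans (h.uu hi0 hi)
  have main : v ∈ A → ∀ i < n, u i ∈ A → {v} ∪ layers u d n ⊆ A := by
    intro hv i hi hui
    have h1 : u (n - 1) ∈ A := by
      by_cases hin : i = n - 1
      · exact hin ▸ hui
      · exact hcy _ (hU _ (by omega)) _ hv _ hui (hvu _ (by omega))
          (neg_lt_neg_iff.1 (hu i (n - 1) (by omega) (by omega)))
    have h2 : ∀ k < n - 1, d k ∈ A := fun k hk =>
      hcx _ (hD _ (by omega)) _ hv _ h1 ((hvxu k (by omega)).trans (h.ud _ _ le_rfl (by omega)))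
        (h.du _ _ hk (by omega))
    rintro w (rfl | ⟨k, hk, rfl | rfl⟩)
    · exact hv
    · by_cases hkn : k = n - 1
      · exact hkn ▸ h1
      · exact hcx _ (hU _ hk) _ hv _ h1 (hvxu k hk) (h.uu (by omega) (by omega))
    · by_cases hkn : k = n - 1
      · exact hcy _ (hD _ hk) _ (h2 0 (by omega)) _ hv (hd 0 k (by omega) hk) (hvd k hk)
      · exact h2 k (by omega)
  have main' : v ∈ A → ∀ r ∈ A, r ∈ layers u d n → {v} ∪ layers u d n ⊆ A := by
    rintro hv r hr ⟨i, hi, rfl | rfl⟩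
    · exact main hv i hi hr
    · exact main hv 0 (by omega) (hcx _ (hU 0 (by omega)) _ hv _ hr hvx
        (h.ud _ _ (by omega) hi))
  rcases hA hp with rfl | hp' <;> rcases hA hq with rfl | hq'
  · exact absurd rfl hpq
  · exact main' hp q hq hq'
  · exact main' hq p hp hp'
  · obtain ⟨i, hi, j, hj, hui, hdj⟩ :=
      h.exists_upper_lower Set.subset_union_right hcx hp hq hpq hp' hq'
    exact main (hcy _ (Or.inl rfl) _ hdj _ hui (hvd j hj) (hvu i hi)) i hi hui

/-- Vertically between `w` and `v` lies `u 0`, and horizontally between `u 0` and `w` lies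
everything else. Any other two points force both `v` and `w`. -/
theorem isPrimeOn_layers_of_corner (hx : x.Injective) (hy : y.Injective) (hn : 0 < n)
    (h : IsAlternation x y u d n) {v w : V} (hvx : ∀ i < n, x (d i) < x v)
    (hvw : x v < x w) (hvy : ∀ i < n, y (u i) < y v)
    (hwd : ∀ i < n, y (d i) < y w) (hwu : ∀ i < n, y w < y (u i)) :
    IsPrimeOn (relPos x y) ({v, w} ∪ layers u d n) := by
  refine isPrimeOn_of_forall_closed hx hy fun A hA hcx hcy p hp q hq hpq => ?_
  have hU : ∀ i < n, u i ∈ {v, w} ∪ layers u d n := fun i hi => Or.inr (upper_mem_layers hi)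
  have hD : ∀ i < n, d i ∈ {v, w} ∪ layers u d n := fun i hi => Or.inr (lower_mem_layers hi)
  have hV : v ∈ {v, w} ∪ layers u d n := Or.inl (by simp)
  have hW : w ∈ {v, w} ∪ layers u d n := Or.inl (by simp)
  have hux : ∀ i < n, x (u i) < x v := fun i hi => (h.ud i i le_rfl hi).trans (hvx i hi)
  have main : v ∈ A → w ∈ A → {v, w} ∪ layers u d n ⊆ A := by
    intro hv hw
    have h0 : u 0 ∈ A := hcy _ (hU 0 hn) _ hw _ hv (hwu 0 hn) (hvy 0 hn)
    rintro r ((rfl | rfl) | ⟨k, hk, rfl | rfl⟩)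
    · exact hv
    · exact hw
    · rcases Nat.eq_zero_or_pos k with rfl | hk0
      · exact h0
      · exact hcx _ (hU _ hk) _ h0 _ hw (h.uu hk0 hk) ((hux k hk).trans hvw)
    · exact hcx _ (hD _ hk) _ h0 _ hw (h.ud _ _ (by omega) hk) ((hvx k hk).trans hvw)
  have main1 : v ∈ A → ∀ r ∈ A, r ∈ layers u d n → {v, w} ∪ layers u d n ⊆ A := by
    have low : v ∈ A → ∀ j < n, d j ∈ A → {v, w} ∪ layers u d n ⊆ A := fun hv j hj hdj =>
      main hv (hcy _ hW _ hdj _ hv (hwd j hj) ((hwu j hj).trans (hvy j hj)))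
    rintro hv r hr ⟨i, hi, rfl | rfl⟩
    · exact low hv i hi (hcx _ (hD i hi) _ hr _ hv (h.ud i i le_rfl hi) (hvx i hi))
    · exact low hv i hi hr
  have main2 : w ∈ A → ∀ r ∈ A, r ∈ layers u d n → {v, w} ∪ layers u d n ⊆ A := by
    rintro hw r hr ⟨i, hi, rfl | rfl⟩
    · exact main (hcx _ hV _ hr _ hw (hux i hi) hvw) hw
    · exact main (hcx _ hV _ hr _ hw (hvx i hi) hvw) hw
  rcases hA hp with (rfl | rfl) | hp' <;> rcases hA hq with (rfl | rfl) | hq'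
  · exact absurd rfl hpq
  · exact main hp hq
  · exact main1 hp q hq hq'
  · exact main hq hp
  · exact absurd rfl hpq
  · exact main2 hp q hq hq'
  · exact main1 hq p hp hp'
  · exact main2 hq p hp hp'
  · obtain ⟨i, hi, j, hj, hui, hdj⟩ :=
      h.exists_upper_lower Set.subset_union_right hcx hp hq hpq hp' hq'
    exact main2 (hcy _ hW _ hdj _ hui (hwd j hj) (hwu i hi)) _ hui (upper_mem_layers hi)

theorem IsAlternation.shift (h : IsAlternation x y u d n) (s l : ℕ) (hl : s + l ≤ n) :
    IsAlternation x y (fun i => u (s + i)) (fun i => d (s + i)) l :=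
  h.comp (s := fun i => s + i) (fun i j hij _ => by omega) (fun i hi => by omega)

theorem IncreasesBelow.shift {f : ℕ → ℤ} (h : IncreasesBelow f n) (s l : ℕ) (hl : s + l ≤ n) :
    IncreasesBelow (fun i => f (s + i)) l :=
  h.comp (s := fun i => s + i) (fun i j hij _ => by omega) (fun i hi => by omega)

theorem IsAlternation.upper_injOn (h : IsAlternation x y u d n) {i j : ℕ} (hi : i < n)
    (hj : j < n) (e : u i = u j) : i = j := by
  by_contra hne
  rcases Nat.lt_or_gt_of_ne hne with hlt | hlt
  · exact (h.uu hlt hj).ne (by rw [e])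
  · exact (h.uu hlt hi).ne (by rw [e])

theorem IsAlternation.lower_injOn (h : IsAlternation x y u d n) {i j : ℕ} (hi : i < n)
    (hj : j < n) (e : d i = d j) : i = j := by
  by_contra hne
  rcases Nat.lt_or_gt_of_ne hne with hlt | hlt
  · exact (h.dd hlt hj).ne (by rw [e])
  · exact (h.dd hlt hi).ne (by rw [e])

theorem block_lt {L M i k : ℕ} (hi : i < M) (hk : k < L) : i * L + k < M * L := by
  have := Nat.mul_le_mul_right L hi
  rw [Nat.succ_mul] at this
  omega

theorem block_le {L M i : ℕ} (hi : i < M) : i * L + L ≤ M * L := by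
  have := Nat.mul_le_mul_right L hi
  rwa [Nat.succ_mul] at this

theorem block_index_injective {L i j k l : ℕ} (hk : k < L) (hl : l < L)
    (e : i * L + k = j * L + l) : i = j := by
  have h1 : (i * L + k) / L = i := by
    rw [mul_comm, Nat.mul_add_div (by omega), Nat.div_eq_of_lt hk, add_zero]
  have h2 : (j * L + l) / L = j := by
    rw [mul_comm, Nat.mul_add_div (by omega), Nat.div_eq_of_lt hl, add_zero]
  rw [← h1, ← h2, e]

/-- The two extra layers per block guarantee two upper and two lower points, which supply the
descending and ascending pairs when `C` is nonempty. -/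
theorem hasAlmostDisjointPrimes_of_blocks [Finite V] {L M : ℕ}
    (h : IsAlternation x y u d (M * (L + 2))) (C : Set V) (hC : C.ncard ≤ 2)
    (hCu : ∀ i < M * (L + 2), u i ∉ C) (hCd : ∀ i < M * (L + 2), d i ∉ C)
    (hprime : ∀ i < M, IsPrimeOn (relPos x y)
      (C ∪ layers (fun k => u (i * (L + 2) + k)) (fun k => d (i * (L + 2) + k)) (L + 2)))
    (hpairs : C = ∅ ∨ IncreasesBelow (fun i => -y (u i)) (M * (L + 2)) ∧
      IncreasesBelow (y ∘ d) (M * (L + 2))) : HasAlmostDisjointPrimes x y L M := by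
  refine ⟨C, fun i => layers (fun k => u (i * (L + 2) + k)) (fun k => d (i * (L + 2) + k)) (L + 2),
    hC, fun i j hi hj hij => ?_, fun i hi => ⟨?_, ?_, hprime i hi, ?_⟩⟩
  · rw [Set.disjoint_left]
    rintro _ ⟨k, hk, rfl | rfl⟩ ⟨l, hl, e | e⟩
    · exact hij (block_index_injective hk hl
        (h.upper_injOn (block_lt hi hk) (block_lt hj hl) e))
    · exact (h.below _ _ (block_lt hj hl) (block_lt hi hk)).ne (congrArg y e.symm)
    · exact (h.below _ _ (block_lt hi hk) (block_lt hj hl)).ne (congrArg y e)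
    · exact hij (block_index_injective hk hl
        (h.lower_injOn (block_lt hi hk) (block_lt hj hl) e))
  · rw [Set.disjoint_right]
    rintro _ ⟨k, hk, rfl | rfl⟩
    · exact hCu _ (block_lt hi hk)
    · exact hCd _ (block_lt hi hk)
  · have hsub : (fun k => u (i * (L + 2) + k)) '' (Finset.range L : Set ℕ) ⊆
        layers (fun k => u (i * (L + 2) + k)) (fun k => d (i * (L + 2) + k)) (L + 2) := by
      rintro _ ⟨k, hk, rfl⟩
      have hk' : k < L := by simpa using hk
      exact ⟨k, by omega, Or.inl rfl⟩
    refine le_trans ?_ (Set.ncard_le_ncard hsub (Set.toFinite _))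
    rw [Set.InjOn.ncard_image, Set.ncard_coe_finset, Finset.card_range]
    intro s hs t ht e
    have hs' : s < L := by simpa using hs
    have ht' : t < L := by simpa using ht
    have := h.upper_injOn (block_lt hi (show s < L + 2 by omega))
      (block_lt hi (show t < L + 2 by omega)) e
    omega
  · refine hpairs.imp_right fun ⟨hu, hd⟩ => ?_
    have h0 := block_lt hi (show 0 < L + 2 by omega)
    have h1 := block_lt hi (show 1 < L + 2 by omega)
    refine ⟨⟨_, lower_mem_layers (i := 0) (by omega), _, lower_mem_layers (i := 1) (by omega),
      h.dd (by omega) h1, hd _ _ (by omega) h1⟩,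
      ⟨_, upper_mem_layers (i := 0) (by omega), _, upper_mem_layers (i := 1) (by omega),
      h.uu (by omega) h1, neg_lt_neg_iff.1 (hu _ _ (by omega) h1)⟩⟩

theorem hasAlmostDisjointPrimes_of_parallel [Finite V] (hx : x.Injective) (hy : y.Injective)
    {L M : ℕ} (h : IsAlternation x y u d (M * (L + 2)))
    (hu : IncreasesBelow (y ∘ u) (M * (L + 2))) (hd : IncreasesBelow (y ∘ d) (M * (L + 2))) :
    HasAlmostDisjointPrimes x y L M := by
  refine hasAlmostDisjointPrimes_of_blocks h ∅ (by simp) (by simp) (by simp) (fun i hi => ?_)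
    (Or.inl rfl)
  rw [Set.empty_union]
  exact isPrimeOn_layers_of_parallel hx hy (h.shift _ _ (block_le hi))
    (hu.shift _ _ (block_le hi)) (hd.shift _ _ (block_le hi))

theorem hasAlmostDisjointPrimes_of_mouth [Finite V] (hx : x.Injective) (hy : y.Injective)
    {L M : ℕ} (h : IsAlternation x y u d (M * (L + 2)))
    (hu : IncreasesBelow (fun i => -y (u i)) (M * (L + 2)))
    (hd : IncreasesBelow (y ∘ d) (M * (L + 2))) {v : V}
    (hvx : ∀ i < M * (L + 2), x v < x (u i)) (hvd : ∀ i < M * (L + 2), y (d i) < y v)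
    (hvu : ∀ i < M * (L + 2), y v < y (u i)) : HasAlmostDisjointPrimes x y L M := by
  refine hasAlmostDisjointPrimes_of_blocks h {v} (by simp) (fun i hi e => ?_) (fun i hi e => ?_)
    (fun i hi => ?_) (Or.inr ⟨hu, hd⟩)
  · exact (hvu i hi).ne (by rw [Set.mem_singleton_iff.1 e])
  · exact (hvd i hi).ne (by rw [Set.mem_singleton_iff.1 e])
  · exact isPrimeOn_layers_of_mouth hx hy (by omega) (h.shift _ _ (block_le hi))
      (hu.shift _ _ (block_le hi)) (hd.shift _ _ (block_le hi))
      (hvx _ (block_lt hi (by omega))) (fun k hk => hvd _ (block_lt hi hk))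
      (fun k hk => hvu _ (block_lt hi hk))

theorem hasAlmostDisjointPrimes_of_corner [Finite V] (hx : x.Injective) (hy : y.Injective)
    {L M : ℕ} (h : IsAlternation x y u d (M * (L + 2)))
    (hu : IncreasesBelow (fun i => -y (u i)) (M * (L + 2)))
    (hd : IncreasesBelow (y ∘ d) (M * (L + 2))) {v w : V}
    (hvx : ∀ i < M * (L + 2), x (d i) < x v)
    (hvw : x v < x w) (hvy : ∀ i < M * (L + 2), y (u i) < y v)
    (hwd : ∀ i < M * (L + 2), y (d i) < y w) (hwu : ∀ i < M * (L + 2), y w < y (u i)) :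
    HasAlmostDisjointPrimes x y L M := by
  refine hasAlmostDisjointPrimes_of_blocks h {v, w} ((Set.ncard_insert_le _ _).trans (by simp))
    ?_ ?_
    (fun i hi => ?_) (Or.inr ⟨hu, hd⟩)
  · rintro i hi (e | e)
    · exact (hvy i hi).ne (by rw [e])
    · exact (hwu i hi).ne (by rw [Set.mem_singleton_iff.1 e])
  · rintro i hi (e | e)
    · exact (hvx i hi).ne (by rw [e])
    · exact (hwd i hi).ne (by rw [Set.mem_singleton_iff.1 e])
  · exact isPrimeOn_layers_of_corner hx hy (by omega) (h.shift _ _ (block_le hi))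
      (fun k hk => hvx _ (block_lt hi hk)) hvw (fun k hk => hvy _ (block_lt hi hk))
      (fun k hk => hwd _ (block_lt hi hk)) (fun k hk => hwu _ (block_lt hi hk))

end Layers

/-! ### Wedges in a prime point set -/

section Wedges

variable {V : Type*} {x y : V → ℤ} {u d : ℕ → V}

/-- A point that slices a rectangle lying inside layer `a + M * (L + 2) + 2` of a wedge and
protrudes from layer `a`. -/
theorem hasAlmostDisjointPrimes_of_protruding [Finite V] (hx : x.Injective) (hy : y.Injective)
    {L M a K : ℕ} (h : IsAlternation x y u d K) (hu : IncreasesBelow (fun i => -y (u i)) K)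
    (hd : IncreasesBelow (y ∘ d) K) (hK : a + (M * (L + 2) + 2) < K) {R : Set V}
    (hR : ∀ r ∈ R, x (d (a + (M * (L + 2) + 2))) < x r ∧
      y (d (a + (M * (L + 2) + 2))) < y r ∧ y r < y (u (a + (M * (L + 2) + 2))))
    {v : V} (hv : Cuts x y v R)
    (hva : ¬ (x (d a) < x v ∧ y (d a) < y v ∧ y v < y (u a))) :
    HasAlmostDisjointPrimes x y L M := by
  generalize hn : M * (L + 2) = n at *
  have hu' : ∀ i j, i < j → j < K → y (u j) < y (u i) := fun i j hij hj =>
    neg_lt_neg_iff.1 (hu i j hij hj)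
  have hd' : ∀ i j, i < j → j < K → y (d i) < y (d j) := hd
  have hal := h.shift (a + 1) n (by omega)
  have hul := hu.shift (a + 1) n (by omega)
  have hdl := hd.shift (a + 1) n (by omega)
  by_cases h1 : x v ≤ x (d a)
  · obtain ⟨r, hr, s, hs, h2, h3⟩ := hv.resolve_left (by
      rintro ⟨r, hr, s, hs, h2, h3⟩
      have := (hR r hr).1
      have := h.dd (show a < a + (n + 2) by omega) hK
      omega)
    have hr' := hR r hr
    have hs' := hR s hs
    subst hn
    refine hasAlmostDisjointPrimes_of_mouth hx hy hal hul hdl (v := v) (fun i hi => ?_)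
      (fun i hi => ?_) (fun i hi => ?_)
    · exact h1.trans_lt (h.du _ _ (by omega) (by omega))
    · have := hd' (a + 1 + i) (a + (M * (L + 2) + 2)) (by omega) hK
      omega
    · have := hu' (a + 1 + i) (a + (M * (L + 2) + 2)) (by omega) hK
      omega
  obtain ⟨r, hr, s, hs, h2, h3⟩ : ∃ r ∈ R, ∃ s ∈ R, x r < x v ∧ x v < x s :=
    hv.resolve_right (by
      rintro ⟨r, hr, s, hs, h2, h3⟩
      have := hR r hr
      have := hR s hs
      have := hu' a (a + (n + 2)) (by omega) hK
      have := hd' a (a + (n + 2)) (by omega) hK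
      omega)
  have hr' := hR r hr
  have hs' := hR s hs
  by_cases h4 : y v < y (u a)
  · have h5 : y v ≤ y (d a) := by omega
    apply HasAlmostDisjointPrimes.of_neg hx hy
    subst hn
    -- Reflection exchanges the rows. The new upper row must come first, so the old one is shifted
    -- by one layer; the `+ 2` leaves room for this.
    have hal' : IsAlternation x (fun v => -y v) (fun i => d (a + 1 + i))
        (fun i => u (a + 1 + i + 1)) (M * (L + 2)) :=
      ⟨fun i j hij hj => h.du _ _ (by omega) (by omega),
        fun i j hij hj => h.ud _ _ (by omega) (by omega),
        fun i j hi hj => neg_lt_neg (h.below _ _ (by omega) (by omega))⟩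
    refine hasAlmostDisjointPrimes_of_corner hx (neg_comp_injective hy) hal'
      (fun i j hij hj => ?_) (fun i j hij hj => ?_) (v := v) (w := s) (fun i hi => ?_) h3
      (fun i hi => ?_) (fun i hi => ?_) (fun i hi => ?_)
    · simpa using hdl i j hij hj
    · exact neg_lt_neg (hu' _ _ (by omega) (by omega))
    · have := h.ud (a + 1 + i + 1) (a + (M * (L + 2) + 2)) (by omega) hK
      omega
    · have := hd' a (a + 1 + i) (by omega) (by omega)
      omega
    · have := hu' (a + 1 + i + 1) (a + (M * (L + 2) + 2)) (by omega) hK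
      omega
    · have := hd' (a + 1 + i) (a + (M * (L + 2) + 2)) (by omega) hK
      omega
  · subst hn
    refine hasAlmostDisjointPrimes_of_corner hx hy hal hul hdl (v := v) (w := s)
      (fun i hi => ?_) h3 (fun i hi => ?_) (fun i hi => ?_) (fun i hi => ?_)
    · have := h.dd (show a + 1 + i < a + (M * (L + 2) + 2) by omega) hK
      omega
    · have := hu' a (a + 1 + i) (by omega) (by omega)
      omega
    · have := hd' (a + 1 + i) (a + (M * (L + 2) + 2)) (by omega) hK
      omega
    · have := hu' (a + 1 + i) (a + (M * (L + 2) + 2)) (by omega) hK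
      omega

/-- Growth starts at the innermost layer. Unless some point protrudes, each step moves outward by at
most `M * (L + 2) + 2` layers, so after `M * (L + 3)` steps `d 0` is still missing, although growth
should have exhausted all points. -/
theorem hasAlmostDisjointPrimes_of_wedge [Finite V] (hx : x.Injective) (hy : y.Injective)
    (hprime : IsPrimeOn (relPos x y) Set.univ) {L M K : ℕ}
    (hK : M * (L + 3) * (M * (L + 2) + 2) + 2 ≤ K) (h : IsAlternation x y u d K)
    (hu : IncreasesBelow (fun i => -y (u i)) K)
    (hd : IncreasesBelow (y ∘ d) K) : HasAlmostDisjointPrimes x y L M := by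
  have hu' : ∀ i j, i < j → j < K → y (u j) < y (u i) := fun i j hij hj =>
    neg_lt_neg_iff.1 (hu i j hij hj)
  have hd' : ∀ i j, i < j → j < K → y (d i) < y (d j) := hd
  have hne : u (K - 1) ≠ d (K - 1) := fun e =>
    (h.below (K - 1) (K - 1) (by omega) (by omega)).ne (by rw [e])
  by_contra hcon
  have huniv := (hasAlmostDisjointPrimes_or_grow_eq_univ hx hy hprime hne L M).resolve_left hcon
  have key : ∀ t a, a + t * (M * (L + 2) + 2) + 2 = K →
      ∀ r ∈ grow x y (u (K - 1)) (d (K - 1)) t,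
        x (d a) < x r ∧ y (d a) < y r ∧ y r < y (u a) := by
    intro t
    induction t with
    | zero =>
      rintro a ha r (rfl | hr)
      · exact ⟨h.du _ _ (by omega) (by omega), h.below _ _ (by omega) (by omega),
          hu' _ _ (by omega) (by omega)⟩
      · rw [Set.mem_singleton_iff.1 hr]
        exact ⟨h.dd (by omega) (by omega), hd' _ _ (by omega) (by omega),
          h.below _ _ (by omega) (by omega)⟩
    | succ t ih =>
      intro a ha r hr
      rw [Nat.succ_mul] at ha
      have ih' := ih (a + (M * (L + 2) + 2)) (by omega)
      rcases hr with hr | hr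
      · have h1 := ih' r hr
        have hlt : a + (M * (L + 2) + 2) < K := by omega
        have h2 := h.dd (show a < a + (M * (L + 2) + 2) by omega) hlt
        have h3 := hu' a (a + (M * (L + 2) + 2)) (by omega) hlt
        have h4 := hd' a (a + (M * (L + 2) + 2)) (by omega) hlt
        omega
      · by_contra hr'
        exact hcon (hasAlmostDisjointPrimes_of_protruding hx hy h hu hd (by omega) ih' hr hr')
  have hlast := key (M * (L + 3)) (K - (M * (L + 3) * (M * (L + 2) + 2) + 2)) (by omega)
    (d 0) (huniv ▸ Set.mem_univ _)
  have h1 := hlast.1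
  rcases Nat.eq_zero_or_pos (K - (M * (L + 3) * (M * (L + 2) + 2) + 2)) with e | e
  · rw [e] at h1
    exact lt_irrefl _ h1
  · exact (h.dd e (by omega)).not_gt h1

/-- Read from right to left, a lower point comes first; dropping it and the last upper point
restores the pattern at the cost of one layer. -/
theorem IsAlternation.reverse {m : ℕ} (h : IsAlternation x y u d (m + 1)) :
    IsAlternation (fun v => -x v) y (fun i => u (m - i)) (fun i => d (m - 1 - i)) m where
  ud i j hij hj := neg_lt_neg (h.du _ _ (by omega) (by omega))
  du i j hij hj := neg_lt_neg (h.ud _ _ (by omega) (by omega))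
  below i j hi hj := h.below _ _ (by omega) (by omega)

theorem hasAlmostDisjointPrimes_of_neg_left (hx : x.Injective) (hy : y.Injective) {L M : ℕ}
    (h : HasAlmostDisjointPrimes (fun v => -x v) y L M) : HasAlmostDisjointPrimes x y L M :=
  .of_swap hx hy (.of_neg hy hx (.of_swap hy (neg_comp_injective hx) h))

theorem isPrimeOn_neg_left (hx : x.Injective) (hy : y.Injective) {S : Set V}
    (h : IsPrimeOn (relPos x y) S) : IsPrimeOn (relPos (fun v => -x v) y) S :=
  (isPrimeOn_swap (neg_comp_injective hx) hy).1
    ((isPrimeOn_neg hy hx).2 ((isPrimeOn_swap hx hy).2 h))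

end Wedges

/-- Once both rows are monotone, a left-right reflection makes the lower row increase; the upper row
then gives the parallel or the wedge case. The value of `m` covers the lengths both need. -/
theorem hasAlmostDisjointPrimes_of_isAlternation (L M : ℕ) : ∃ K : ℕ, ∀ {V : Type} [Finite V]
    {x y : V → ℤ}, x.Injective → y.Injective → IsPrimeOn (relPos x y) Set.univ →
    (∃ u d, IsAlternation x y u d K) → HasAlmostDisjointPrimes x y L M := by
  set m := M * (L + 3) * (M * (L + 2) + 2) + 2 + M * (L + 2) with hm
  obtain ⟨K, hK⟩ := IsAlternation.exists_monotone (m + 1)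
  refine ⟨K, fun {V _ x y} hx hy hprime ⟨u₀, d₀, h₀⟩ => ?_⟩
  obtain ⟨u, d, h, hu, hd⟩ := hK hy h₀
  have hx' := neg_comp_injective hx
  have hprime' := isPrimeOn_neg_left hx hy hprime
  have trunc : ∀ {f : ℕ → ℤ} {k l : ℕ}, l ≤ k → IncreasesBelow f k → IncreasesBelow f l :=
    fun hl hf i j hij hj => hf i j hij (by omega)
  have truncA : ∀ {x' y' : V → ℤ} {u' d' : ℕ → V} {k l : ℕ}, l ≤ k →
      IsAlternation x' y' u' d' k → IsAlternation x' y' u' d' l := fun hl hf =>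
    ⟨fun i j hij hj => hf.ud i j hij (by omega), fun i j hij hj => hf.du i j hij (by omega),
      fun i j hi hj => hf.below i j (by omega) (by omega)⟩
  rcases hd with hd | hd
  · rcases hu with hu | hu
    · exact hasAlmostDisjointPrimes_of_parallel hx hy (truncA (by omega) h) (trunc (by omega) hu)
        (trunc (by omega) hd)
    · exact hasAlmostDisjointPrimes_of_wedge hx hy hprime (by omega) h hu hd
  · apply hasAlmostDisjointPrimes_of_neg_left hx hy
    have hd' : IncreasesBelow (y ∘ fun i => d (m - 1 - i)) m := fun i j hij hj =>
      neg_lt_neg_iff.1 (hd (m - 1 - j) (m - 1 - i) (by omega) (by omega))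
    rcases hu with hu | hu
    · exact hasAlmostDisjointPrimes_of_wedge hx' hy hprime' (by omega) h.reverse
        (fun i j hij hj => neg_lt_neg (hu (m - j) (m - i) (by omega) (by omega))) hd'
    · exact hasAlmostDisjointPrimes_of_parallel hx' hy (truncA (by omega) h.reverse)
        (trunc (show M * (L + 2) ≤ m by omega) fun i j hij hj =>
          neg_lt_neg_iff.1 (hu (m - j) (m - i) (by omega) (by omega)))
        (trunc (by omega) hd')

/-- Sufficiently many points forming a prime set contain many large almost disjoint prime sets. -/
theorem exists_hasAlmostDisjointPrimes (L M : ℕ) : ∃ N : ℕ, ∀ {V : Type} [Finite V]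
    {x y : V → ℤ}, x.Injective → y.Injective → IsPrimeOn (relPos x y) Set.univ →
    N ≤ Nat.card V → HasAlmostDisjointPrimes x y L M := by
  obtain ⟨K, hK⟩ := hasAlmostDisjointPrimes_of_isAlternation L M
  choose B hB using hasAlternation_of_common_level K
  set T := M * (L + 3) with hT
  set N := (∑ t ∈ Finset.range (T + 1), B t) + 1 with hN
  refine ⟨2 * N, fun {V _ x y} hx hy hprime hcard => ?_⟩
  classical
  have := Fintype.ofFinite V
  by_contra hcon
  have hV : 2 * N ≤ (Finset.univ : Finset V).card := by
    rwa [Finset.card_univ, ← Nat.card_eq_fintype_card]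
  have : Nonempty V := by
    rw [← Fintype.card_pos_iff, ← Finset.card_univ]
    omega
  -- Pairing consecutive points from left to right gives `N` horizontally disjoint starting pairs.
  -- The target `c` may be any point.
  obtain ⟨s, hs, -⟩ := exists_sorted_enumeration x Finset.univ hx.injOn
  set a : ℕ → V := fun j => s (2 * j) with ha
  set b : ℕ → V := fun j => s (2 * j + 1) with hb
  have hab : ∀ j ∈ Finset.range N, x (a j) < x (b j) := fun j hj => by
    rw [Finset.mem_range] at hj
    exact hs _ _ (by omega) (by omega)
  have hba : ∀ i ∈ Finset.range N, ∀ j ∈ Finset.range N, i < j → x (b i) < x (a j) :=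
    fun i hi j hj hij => by
      rw [Finset.mem_range] at hi hj
      exact hs _ _ (by omega) (by omega)
  set c := s 0 with hc
  have hlevel : ∀ j ∈ Finset.range N, ∃ t, t < T + 1 ∧ c ∈ grow x y (a j) (b j) t ∧
      ∀ r < t, c ∉ grow x y (a j) (b j) r := by
    intro j hj
    have hne : a j ≠ b j := fun e => (hab j hj).ne (by rw [e])
    have huniv :=
      (hasAlmostDisjointPrimes_or_grow_eq_univ hx hy hprime hne L M).resolve_left hcon
    have hex : ∃ t, c ∈ grow x y (a j) (b j) t := ⟨T, huniv ▸ Set.mem_univ _⟩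
    exact ⟨Nat.find hex, Nat.lt_succ_of_le (Nat.find_min' hex (huniv ▸ Set.mem_univ _)),
      Nat.find_spec hex, fun r hr => Nat.find_min hex hr⟩
  obtain ⟨t, ht, hlt⟩ : ∃ t ∈ Finset.range (T + 1), B t < ((Finset.range N).filter fun j =>
      c ∈ grow x y (a j) (b j) t ∧ ∀ r < t, c ∉ grow x y (a j) (b j) r).card := by
    by_contra hle
    push Not at hle
    have h1 : Finset.range N ⊆ (Finset.range (T + 1)).biUnion fun t => (Finset.range N).filter
        fun j => c ∈ grow x y (a j) (b j) t ∧ ∀ r < t, c ∉ grow x y (a j) (b j) r := fun j hj => by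
      obtain ⟨t, ht, h⟩ := hlevel j hj
      exact Finset.mem_biUnion.2 ⟨t, Finset.mem_range.2 ht, Finset.mem_filter.2 ⟨hj, h⟩⟩
    have h2 := (Finset.card_le_card h1).trans (Finset.card_biUnion_le.trans
      (Finset.sum_le_sum hle))
    rw [Finset.card_range] at h2
    omega
  have hsub := Finset.filter_subset (fun j => c ∈ grow x y (a j) (b j) t ∧
    ∀ r < t, c ∉ grow x y (a j) (b j) r) (Finset.range N)
  have hx' := neg_comp_injective hx
  have hy' := neg_comp_injective hy
  have hprime' := (isPrimeOn_swap hx hy).2 hprime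
  apply hcon
  rcases hB t hx hy _ c (fun j hj => hab j (hsub hj))
    (fun i hi j hj => hba i (hsub hi) j (hsub hj))
    (fun j hj => (Finset.mem_filter.1 hj).2) hlt with h | h | h | h
  · exact hK hx hy hprime h
  · exact .of_neg hx hy (hK hx hy' ((isPrimeOn_neg hx hy).2 hprime) h)
  · exact .of_swap hx hy (hK hy hx hprime' h)
  · exact .of_swap hx hy (.of_neg hy hx (hK hy hx' ((isPrimeOn_neg hy hx).2 hprime') h))

/-! ### From prime point sets back to simple permutations and copies -/

section Permutations

variable {n : ℕ} {π : Equiv.Perm (Fin n)}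

/-- The horizontal coordinate of the points of the plot of a permutation. -/
def position (i : Fin n) : ℤ := ((i : ℕ) : ℤ)

/-- The vertical coordinate of the points of the plot of a permutation. -/
def height (π : Equiv.Perm (Fin n)) (i : Fin n) : ℤ := ((π i : ℕ) : ℤ)

theorem position_lt {i j : Fin n} : position i < position j ↔ i < j := by
  simp [position]

theorem height_lt {i j : Fin n} : height π i < height π j ↔ π i < π j := by
  simp [height]

theorem position_injective : (position : Fin n → ℤ).Injective := fun i j h => by
  simpa [position, Fin.val_inj] using h

theorem height_injective (π : Equiv.Perm (Fin n)) : (height π).Injective := fun i j h => by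
  simpa [height, Fin.val_inj] using h

theorem isPrimeOn_univ_of_isSimple (h : IsSimple ⟨n, π⟩) :
    IsPrimeOn (relPos position (height π)) Set.univ := by
  intro A hA
  rw [isModule_relPos_iff position_injective (height_injective π)] at hA
  refine h A ⟨⟨fun a ha b hb v hv => ?_⟩, ⟨?_⟩⟩
  · by_contra hvA
    refine hA.2 v trivial hvA (Or.inl ⟨a, ha, b, hb, position_lt.2 ?_, position_lt.2 ?_⟩)
    · exact lt_of_le_of_ne hv.1 fun e => hvA (e ▸ ha)
    · exact lt_of_le_of_ne hv.2 fun e => hvA (e ▸ hb)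
  · rintro _ ⟨a, ha, rfl⟩ _ ⟨b, hb, rfl⟩ w hw
    obtain ⟨v, rfl⟩ := π.surjective w
    refine ⟨v, ?_, rfl⟩
    by_contra hvA
    refine hA.2 v trivial hvA (Or.inr ⟨a, ha, b, hb, height_lt.2 ?_, height_lt.2 ?_⟩)
    · exact lt_of_le_of_ne hw.1 fun e => hvA (π.injective e ▸ ha)
    · exact lt_of_le_of_ne hw.2 fun e => hvA (π.injective e ▸ hb)

/-- The standardization of a prime set of points is a simple permutation. -/
theorem exists_isSimple_of_isPrimeOn {S : Set (Fin n)}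
    (hS : IsPrimeOn (relPos position (height π)) S) :
    ∃ σ : FinPerm, IsSimple σ ∧ σ.length = S.ncard ∧ ∃ e ∈ copies σ ⟨n, π⟩, Set.range e = S := by
  classical
  have hcard : (S.toFinset.image π).card = S.toFinset.card :=
    Finset.card_image_of_injective _ π.injective
  set e := S.toFinset.orderEmbOfFin rfl with he
  set f := (S.toFinset.image π).orderIsoOfFin hcard with hf
  have hrange : Set.range e = S := by simp [he]
  have hmem : ∀ i, π (e i) ∈ S.toFinset.image π := fun i =>
    Finset.mem_image_of_mem _ (Finset.orderEmbOfFin_mem _ _ _)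
  set g : Fin S.toFinset.card → Fin S.toFinset.card := fun i => f.symm ⟨π (e i), hmem i⟩ with hg
  have hglt : ∀ i j, g i < g j ↔ π (e i) < π (e j) := fun i j => by
    simp [hg, OrderIso.lt_iff_lt]
  have hginj : g.Injective := fun i j h => by
    have := f.symm.injective h
    exact e.injective (π.injective (Subtype.mk.inj this))
  set σ := Equiv.ofBijective g (Finite.injective_iff_bijective.1 hginj) with hσ
  have hσlt : ∀ i j, σ i < σ j ↔ π (e i) < π (e j) := hglt
  refine ⟨⟨_, σ⟩, fun I hI => ?_, (Set.ncard_eq_toFinset_card' S).symm, e, hσlt, hrange⟩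
  have hmod : IsModule (relPos position (height π)) S (e '' I) := by
    rw [isModule_relPos_iff position_injective (height_injective π)]
    refine ⟨(Set.image_subset_range _ _).trans hrange.subset, fun v hv hvI hcut => ?_⟩
    rw [← hrange] at hv
    obtain ⟨k, rfl⟩ := hv
    apply hvI
    rcases hcut with ⟨_, ⟨i, hi, rfl⟩, _, ⟨j, hj, rfl⟩, h1, h2⟩ |
      ⟨_, ⟨i, hi, rfl⟩, _, ⟨j, hj, rfl⟩, h1, h2⟩
    · rw [position_lt, OrderEmbedding.lt_iff_lt] at h1 h2
      exact ⟨k, hI.1.out hi hj ⟨h1.le, h2.le⟩, rfl⟩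
    · rw [height_lt, ← hσlt] at h1 h2
      obtain ⟨k', hk', hkk⟩ := hI.2.out (Set.mem_image_of_mem _ hi) (Set.mem_image_of_mem _ hj)
        ⟨h1.le, h2.le⟩
      exact ⟨k', hk', by rw [σ.injective hkk]⟩
  rcases hS _ hmod with h | h
  · left
    intro i hi j hj
    exact e.injective (h (Set.mem_image_of_mem _ hi) (Set.mem_image_of_mem _ hj))
  · right
    exact Set.image_injective.2 e.injective (h.trans (hrange.symm.trans Set.image_univ.symm))

theorem trans_mem_copies {β σ τ : FinPerm} {g : Fin β.length ↪o Fin σ.length}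
    {e : Fin σ.length ↪o Fin τ.length} (hg : g ∈ copies β σ) (he : e ∈ copies σ τ) :
    g.trans e ∈ copies β τ :=
  fun i j => (hg i j).trans (he (g i) (g j))

theorem exists_copy_of_length_one {β : FinPerm} (hβ : β.length = 1) (p : Fin n) :
    ∃ e ∈ copies β ⟨n, π⟩, ∀ i, e i = p := by
  obtain ⟨m, τ⟩ := β
  obtain rfl : m = 1 := hβ
  refine ⟨OrderEmbedding.ofStrictMono (fun _ => p) fun i j hij => ?_, fun i j => ?_, fun i => rfl⟩
  · exact absurd hij (by simp [Subsingleton.elim i j])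
  · simp [Subsingleton.elim i j]

theorem exists_copy_of_length_two {β : FinPerm} (hβ : β.length = 2) {T : Set (Fin n)}
    (hasc : ∃ p ∈ T, ∃ q ∈ T, p < q ∧ π p < π q) (hdesc : ∃ p ∈ T, ∃ q ∈ T, p < q ∧ π q < π p) :
    ∃ e ∈ copies β ⟨n, π⟩, ∀ i, e i ∈ T := by
  obtain ⟨m, τ⟩ := β
  obtain rfl : m = 2 := hβ
  obtain ⟨p, hp, q, hq, hpq, h⟩ : ∃ p ∈ T, ∃ q ∈ T, p < q ∧
      (τ 0 < τ 1 ↔ π p < π q) ∧ (τ 1 < τ 0 ↔ π q < π p) := by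
    have hne : τ 0 ≠ τ 1 := τ.injective.ne (by decide)
    rcases lt_or_gt_of_ne hne with h | h
    · obtain ⟨p, hp, q, hq, h1, h2⟩ := hasc
      exact ⟨p, hp, q, hq, h1, by simp [h, h2], by simp [h.not_gt, h2.not_gt]⟩
    · obtain ⟨p, hp, q, hq, h1, h2⟩ := hdesc
      exact ⟨p, hp, q, hq, h1, by simp [h.not_gt, h2.not_gt], by simp [h, h2]⟩
  have hmono : StrictMono ![p, q] := fun i j hij => by
    fin_cases i <;> fin_cases j <;> simp_all
  refine ⟨OrderEmbedding.ofStrictMono ![p, q] hmono, fun i j => ?_, fun i => ?_⟩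
  · change τ i < τ j ↔ π (![p, q] i) < π (![p, q] j)
    fin_cases i <;> fin_cases j <;> simp_all
  · change ![p, q] i ∈ T
    fin_cases i <;> simp_all

theorem finite_setOf_length_lt (N : ℕ) : {π : FinPerm | π.length < N}.Finite := by
  have : {π : FinPerm | π.length < N} ⊆
      Set.range fun s : Σ n : Fin N, Equiv.Perm (Fin n) => (⟨s.1, s.2⟩ : FinPerm) := by
    rintro ⟨n, π⟩ h
    exact ⟨⟨⟨n, h⟩, π⟩, rfl⟩
  exact (Set.finite_range _).subset this

/-- A large prime set of points contains a copy of some basis element, and the copy can be chosen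
not to lie entirely within a given small part of the set. -/
theorem exists_copy_meeting {k : ℕ} {β : Fin k → FinPerm} (hβ : ∀ i, 1 ≤ (β i).length) {L : ℕ}
    (hL : ∀ σ ∈ Si (Av β), σ.length < L) {C S : Set (Fin n)} (hC : C.ncard ≤ 2)
    (hS : L ≤ S.ncard) (hprime : IsPrimeOn (relPos position (height π)) (C ∪ S))
    (hpairs : C = ∅ ∨ (∃ p ∈ S, ∃ q ∈ S, position p < position q ∧ height π p < height π q) ∧
        ∃ p ∈ S, ∃ q ∈ S, position p < position q ∧ height π q < height π p) :
    ∃ i, ∃ e ∈ copies (β i) ⟨n, π⟩, (∃ p, e p ∈ S) ∧ ∀ p, e p ∈ C ∪ S := by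
  obtain ⟨σ, hσ, hlen, e, he, hrange⟩ := exists_isSimple_of_isPrimeOn hprime
  have hlt : L ≤ σ.length := by
    rw [hlen]
    exact hS.trans (Set.ncard_le_ncard Set.subset_union_right (Set.toFinite _))
  have hAv : σ ∉ Av β := fun h => (hL σ ⟨h, hσ⟩).not_ge hlt
  simp only [Av, Set.mem_ofPred_eq, not_forall, not_not] at hAv
  obtain ⟨i, g, hg⟩ := hAv
  have hge : ∀ p, e (g p) ∈ C ∪ S := fun p => hrange.subset (Set.mem_range_self _)
  refine ⟨i, ?_⟩
  by_cases hmeet : ∃ p, e (g p) ∈ S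
  · exact ⟨g.trans e, trans_mem_copies hg he, hmeet, hge⟩
  push Not at hmeet
  -- A copy inside `C` has length at most two, so it can be replaced by a copy inside `S`: a single
  -- point, or an ascending or descending pair.
  have hgC : ∀ p, e (g p) ∈ C := fun p => (hge p).resolve_right (hmeet p)
  have hle : (β i).length ≤ 2 := by
    have h1 : Set.range (g.trans e) ⊆ C := by
      rintro _ ⟨p, rfl⟩
      exact hgC p
    have h2 := Set.ncard_le_ncard h1 (Set.toFinite _)
    rw [← Set.image_univ, Set.ncard_image_of_injective _ (g.trans e).injective, Set.ncard_univ,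
      Nat.card_eq_fintype_card, Fintype.card_fin] at h2
    omega
  have hpos := hβ i
  rcases hpairs with rfl | ⟨hasc, hdesc⟩
  · exact absurd (hgC ⟨0, hpos⟩) (Set.notMem_empty _)
  simp only [position_lt, height_lt] at hasc hdesc
  rcases (show (β i).length = 1 ∨ (β i).length = 2 by omega) with h | h
  · obtain ⟨p, hp, -⟩ := hasc
    obtain ⟨f, hf, hfp⟩ := exists_copy_of_length_one (π := π) h p
    exact ⟨f, hf, ⟨⟨0, hpos⟩, by rwa [hfp]⟩, fun q => Or.inr (by rwa [hfp])⟩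
  · obtain ⟨f, hf, hfS⟩ := exists_copy_of_length_two h hasc hdesc
    exact ⟨f, hf, ⟨⟨0, hpos⟩, hfS _⟩, fun q => Or.inr (hfS q)⟩

end Permutations

end PermPattern

theorem mainTheorem5 (k : ℕ) (β : Fin k → PermPattern.FinPerm)
    (hβ : ∀ i, 1 ≤ (β i).length)
    (hfin : (PermPattern.Si (PermPattern.Av β)).Finite) (r : Fin k → ℕ) :
    (PermPattern.Si (PermPattern.AvAtMost β r)).Finite := by
  classical
  obtain ⟨L, hL⟩ : ∃ L, ∀ σ ∈ PermPattern.Si (PermPattern.Av β), σ.length < L := by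
    obtain ⟨B, hB⟩ := (hfin.image PermPattern.FinPerm.length).bddAbove
    exact ⟨B + 1, fun σ hσ => Nat.lt_succ_of_le (hB (Set.mem_image_of_mem _ hσ))⟩
  obtain ⟨N, hN⟩ := PermPattern.exists_hasAlmostDisjointPrimes L (∑ i, r i + 1)
  refine (PermPattern.finite_setOf_length_lt N).subset ?_
  rintro ⟨n, π⟩ ⟨hr, hπ⟩
  by_contra hlen
  obtain ⟨C, S, hC, hdisj, hS⟩ := hN PermPattern.position_injective
    (PermPattern.height_injective π) (PermPattern.isPrimeOn_univ_of_isSimple hπ)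
    (by simpa using hlen)
  have key : ∀ j : Fin (∑ i, r i + 1), ∃ s : Σ i, Fin (β i).length ↪o Fin n,
      s.2 ∈ PermPattern.copies (β s.1) ⟨n, π⟩ ∧ (∃ p, s.2 p ∈ S j) ∧ ∀ p, s.2 p ∈ C ∪ S j := by
    intro j
    obtain ⟨-, h2, h3, h4⟩ := hS j j.2
    obtain ⟨i, e, he⟩ := PermPattern.exists_copy_meeting hβ hL hC h2 h3 h4
    exact ⟨⟨i, e⟩, he⟩
  choose F hF using key
  -- A copy chosen for `j` meets `S j`, whereas one chosen for `l ≠ j` stays in `C ∪ S l`, which is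
  -- disjoint from `S j`.
  have hinj : F.Injective := fun j l hjl => by
    by_contra hne
    obtain ⟨p, hp⟩ := (hF j).2.1
    have hl := (hF l).2.2
    rw [← hjl] at hl
    rcases hl p with h | h
    · exact Set.disjoint_left.1 (hS j j.2).1 h hp
    · exact Set.disjoint_left.1 (hdisj j l j.2 l.2 fun e => hne (Fin.ext e)) hp h
  have hcard : (Finset.univ : Finset (Fin (∑ i, r i + 1))).card ≤
      (Finset.univ.sigma fun i => (PermPattern.copies (β i) ⟨n, π⟩).toFinset).card :=
    Finset.card_le_card_of_injOn F (fun j _ => by simpa using (hF j).1) hinj.injOn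
  rw [Finset.card_sigma, Finset.card_univ, Fintype.card_fin] at hcard
  have hle : ∑ i, (PermPattern.copies (β i) ⟨n, π⟩).toFinset.card ≤ ∑ i, r i :=
    Finset.sum_le_sum fun i _ => by
      rw [← Set.ncard_eq_toFinset_card']
      exact hr i
  omega
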